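/- Let $B\in\mathbb{R}^{m\times q}$, $\gamma\in\mathbb{R}^p$, $\sigma\ge 0$, let $X_i\in\mathbb{R}^{m\times q}$, $z_i\in\mathbb{R}^p$ ($i\ge 1$) be given (non-random), and let $y_i=\langle X_i,B\rangle+\langle z_i,\gamma\rangle+\varepsilon_i$, where the $\varepsilon_i$ are independent $\mathcal N(0,\sigma^2)$ random variables. Let $\mathrm{vec}$ stack the columns of a matrix, and suppose that, as $n\to\infty$, $$\frac1n\sum_{i=1}^n \mathrm{vec}(X_i)\mathrm{vec}(X_i)^\top\to C,\qquad \frac1n\sum_{i=1}^n z_iz_i^\top\to D,\qquad \frac1n\sum_{i=1}^n \mathrm{vec}(X_i)z_i^\top\to H,$$ and that $S=\begin{pmatrix}C&H\\H^\top&D\end{pmatrix}$ is positive definite. Let $\rho_n,\lambda_n\ge 0$ with $\rho_n/\sqrt n\to\rho_0\ge 0$ and $\lambda_n/\sqrt n\to\lambda_0\ge 0$, and let the random pair $(\widehat B_n,\hat\gamma_n)$ be a minimizer over $(U,\beta)\in\mathbb{R}^{m\times q}\times\mathbb{R}^p$ of $$\frac1n\sum_{i=1}^n\big(y_i-\langle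 X_i,U\rangle-\langle z_i,\beta\rangle\big)^2+\frac{\rho_n}{n}\|U\|_*+\frac{\lambda_n}{n}\|\beta\|_1,$$ where $\|\cdot\|_*$ is the nuclear norm. For $U\in\mathbb{R}^{m\times q}$ put $$\delta_B(U)=\max_{(P,Q)}\Big(\sum_{i=1}^{r}P_{\cdot i}^\top UQ_{\cdot i}+\sum_{i=r+1}^{\min\{m,q\}}\big|P_{\cdot i}^\top UQ_{\cdot i}\big|\Big),\qquad r=\mathrm{rank}(B),$$ the maximum being over all singular value decompositions $B=P\Sigma Q^\top$, with $P\in\mathbb{R}^{m\times m}$, $Q\in\mathbb{R}^{q\times q}$ orthogonal and $\Sigma\in\mathbb{R}^{m\times q}$ rectangular diagonal with diagonal $\alpha_1\ge\dots\ge\alpha_r>\alpha_{r+1}=\dots=\alpha_{\min\{m,q\}}=0$. Then $\delta_B(U)=\lim_{t\downarrow0}(\|B+tU\|_*-\|B\|_*)/t$ is the directional derivative of the nuclear norm at $B$. Let $\begin{pmatrix}w_1\\w_2\end{pmatrix}\sim\mathcal N(0,\sigma^2S)$ in $\mathbb{R}^{mq+p}$ and $$F(U,\beta)=\mathrm{vec}(U)^\top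 C\,\mathrm{vec}(U)+\beta^\top D\beta+2\,\mathrm{vec}(U)^\top H\beta-2\,\mathrm{vec}(U)^\top w_1-2\beta^\top w_2+\rho_0\,\delta_B(U)+\lambda_0\sum_{i=1}^p\big(\beta_i\,\mathrm{sgn}(\gamma_i)I(\gamma_i\ne0)+|\beta_i|I(\gamma_i=0)\big).$$ Then $F$ has a unique minimizer, which is a measurable function of $(w_1,w_2)$, and $$\sqrt n\,(\widehat B_n-B,\ \hat\gamma_n-\gamma)\ \longrightarrow\ \operatorname*{arg\,min}_{U,\beta}F(U,\beta)\quad\text{in distribution as } n\to\infty.$$ In particular, if $\rho_n=o(\sqrt n)$ and $\lambda_n=o(\sqrt n)$, the minimizer $(U^*,\beta^*)$ of $F$ satisfies $\begin{pmatrix}\mathrm{vec}(U^*)\\\beta^*\end{pmatrix}=S^{-1}\begin{pmatrix}w_1\\w_2\end{pmatrix}\sim\mathcal N(0,\sigma^2S^{-1})$. -/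

import Mathlib

open MeasureTheory ProbabilityTheory Filter Topology Asymptotics
open scoped NNReal Matrix

noncomputable section

namespace MatrixRegression

/-- Index set of the stacked vector `[vec U; β]`, for `U ∈ ℝ^{m×q}` and `β ∈ ℝ^p`. -/
abbrev Idx (m q p : ℕ) : Type := (Fin q × Fin m) ⊕ Fin p

/-- The Euclidean space `ℝ^{mq+p}` of stacked vectors `[vec U; β]`. -/
abbrev Stacked (m q p : ℕ) : Type := EuclideanSpace ℝ (Idx m q p)

/-- The pair `(U, β)` as the vector `[vec U; β]`; `vec` stacks the columns. -/
def stack {m q p : ℕ} (U : Matrix (Fin m) (Fin q) ℝ) (β : Fin p → ℝ) : Stacked m q p :=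
  WithLp.toLp 2 (Sum.elim U.vec β)

/-- The nuclear norm: the sum of the `min m q` singular values. -/
def nuclearNorm {m q : ℕ} (U : Matrix (Fin m) (Fin q) ℝ) : ℝ :=
  ∑ i ∈ Finset.range (min m q), (Matrix.toEuclideanLin U).singularValues i

/-- The `ℓ₁` norm of a vector. -/
def l1Norm {p : ℕ} (β : Fin p → ℝ) : ℝ := ∑ i, |β i|

/-- The trace inner product `⟨X, U⟩` of two matrices. -/
def matInner {m q : ℕ} (X U : Matrix (Fin m) (Fin q) ℝ) : ℝ := ∑ i, ∑ j, X i j * U i j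

/-- The objective
`Z_n(U, β) = (1/n) ∑_{i<n} (y_i - ⟨X_i, U⟩ - ⟨z_i, β⟩)² + (ρ/n) ‖U‖_* + (lam/n) ‖β‖₁`. -/
def objective {m q p : ℕ} (X : ℕ → Matrix (Fin m) (Fin q) ℝ) (z : ℕ → Fin p → ℝ) (y : ℕ → ℝ)
    (n : ℕ) (ρ lam : ℝ) (U : Matrix (Fin m) (Fin q) ℝ) (β : Fin p → ℝ) : ℝ :=
  (1 / (n : ℝ)) * ∑ i ∈ Finset.range n, (y i - matInner (X i) U - z i ⬝ᵥ β) ^ 2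
    + ρ / n * nuclearNorm U + lam / n * l1Norm β

/-- `C_n = (1/n) ∑_{i<n} vec(X_i) vec(X_i)ᵀ`. -/
def gramC {m q : ℕ} (X : ℕ → Matrix (Fin m) (Fin q) ℝ) (n : ℕ) :
    Matrix (Fin q × Fin m) (Fin q × Fin m) ℝ :=
  (1 / (n : ℝ)) • ∑ i ∈ Finset.range n, Matrix.vecMulVec (X i).vec (X i).vec

/-- `D_n = (1/n) ∑_{i<n} z_i z_iᵀ`. -/
def gramD {p : ℕ} (z : ℕ → Fin p → ℝ) (n : ℕ) : Matrix (Fin p) (Fin p) ℝ :=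
  (1 / (n : ℝ)) • ∑ i ∈ Finset.range n, Matrix.vecMulVec (z i) (z i)

/-- `H_n = (1/n) ∑_{i<n} vec(X_i) z_iᵀ`. -/
def gramH {m q p : ℕ} (X : ℕ → Matrix (Fin m) (Fin q) ℝ) (z : ℕ → Fin p → ℝ) (n : ℕ) :
    Matrix (Fin q × Fin m) (Fin p) ℝ :=
  (1 / (n : ℝ)) • ∑ i ∈ Finset.range n, Matrix.vecMulVec (X i).vec (z i)

/-- The block matrix `S = [[C, H], [Hᵀ, D]]`. -/
def blockS {m q p : ℕ} (C : Matrix (Fin q × Fin m) (Fin q × Fin m) ℝ)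
    (D : Matrix (Fin p) (Fin p) ℝ) (H : Matrix (Fin q × Fin m) (Fin p) ℝ) :
    Matrix (Idx m q p) (Idx m q p) ℝ :=
  Matrix.fromBlocks C H Hᵀ D

/-- The `m × q` rectangular diagonal matrix with diagonal `α`. -/
def rectDiag {m q : ℕ} (α : Fin (min m q) → ℝ) : Matrix (Fin m) (Fin q) ℝ :=
  Matrix.of fun i j =>
    if h : (i : ℕ) = (j : ℕ) then α ⟨i, lt_min i.isLt (h ▸ j.isLt)⟩ else 0

/-- `B = P Σ Qᵀ` is a singular value decomposition: `P`, `Q` are orthogonal and `Σ` is rectangular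
diagonal with `α_1 ≥ ⋯ ≥ α_r > α_{r+1} = ⋯ = α_{min m q} = 0`, where `r = rank B`. -/
structure IsSVD {m q : ℕ} (B : Matrix (Fin m) (Fin q) ℝ) (P : Matrix (Fin m) (Fin m) ℝ)
    (α : Fin (min m q) → ℝ) (Q : Matrix (Fin q) (Fin q) ℝ) : Prop where
  left_mem : P ∈ Matrix.orthogonalGroup (Fin m) ℝ
  right_mem : Q ∈ Matrix.orthogonalGroup (Fin q) ℝ
  antitone : Antitone α
  pos : ∀ i : Fin (min m q), (i : ℕ) < B.rank → 0 < α i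
  zero : ∀ i : Fin (min m q), B.rank ≤ (i : ℕ) → α i = 0
  eq : B = P * rectDiag α * Qᵀ

/-- The number `P_{·i}ᵀ U Q_{·i}`. -/
def svdCoord {m q : ℕ} (P : Matrix (Fin m) (Fin m) ℝ) (Q : Matrix (Fin q) (Fin q) ℝ)
    (U : Matrix (Fin m) (Fin q) ℝ) (i : Fin (min m q)) : ℝ :=
  P.col (Fin.castLE (min_le_left m q) i) ⬝ᵥ (U *ᵥ Q.col (Fin.castLE (min_le_right m q) i))

/-- `∑_{i ≤ r} P_{·i}ᵀ U Q_{·i} + ∑_{r < i ≤ min m q} |P_{·i}ᵀ U Q_{·i}|`. -/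
def svdTerm {m q : ℕ} (r : ℕ) (P : Matrix (Fin m) (Fin m) ℝ) (Q : Matrix (Fin q) (Fin q) ℝ)
    (U : Matrix (Fin m) (Fin q) ℝ) : ℝ :=
  ∑ i : Fin (min m q), if (i : ℕ) < r then svdCoord P Q U i else |svdCoord P Q U i|

/-- The directional derivative of the nuclear norm at `B` in the direction `U`, through the
singular value decompositions of `B`: the value of `svdTerm` at a decomposition adapted to the
direction `U`, that is, one for which it is largest. (The decomposition is not unique, and when
`B` has a multiple zero singular value, or `m ≠ q` and `B` is rank deficient, no single one serves
all directions.) -/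
def nuclearDir {m q : ℕ} (B U : Matrix (Fin m) (Fin q) ℝ) : ℝ :=
  sSup {t : ℝ | ∃ P α Q, IsSVD B P α Q ∧ t = svdTerm B.rank P Q U}

/-- The directional derivative of the `ℓ₁` norm at `γ` in the direction `β`:
`∑ i, (β_i sgn(γ_i) I(γ_i ≠ 0) + |β_i| I(γ_i = 0))`. -/
def l1Dir {p : ℕ} (γ β : Fin p → ℝ) : ℝ :=
  ∑ i, (β i * Real.sign (γ i) * (if γ i ≠ 0 then 1 else 0) + |β i| * (if γ i = 0 then 1 else 0))

/-- The limiting objective `F(U, β)`, at the value `w = [w₁; w₂]` of the Gaussian vector. -/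
def limitObjective {m q p : ℕ} (C : Matrix (Fin q × Fin m) (Fin q × Fin m) ℝ)
    (D : Matrix (Fin p) (Fin p) ℝ) (H : Matrix (Fin q × Fin m) (Fin p) ℝ)
    (B : Matrix (Fin m) (Fin q) ℝ) (γ : Fin p → ℝ) (ρ₀ lam₀ : ℝ) (w : Stacked m q p)
    (U : Matrix (Fin m) (Fin q) ℝ) (β : Fin p → ℝ) : ℝ :=
  U.vec ⬝ᵥ (C *ᵥ U.vec) + β ⬝ᵥ (D *ᵥ β) + 2 * (U.vec ⬝ᵥ (H *ᵥ β))
    - 2 * (U.vec ⬝ᵥ fun k => w (Sum.inl k)) - 2 * (β ⬝ᵥ fun k => w (Sum.inr k))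
    + ρ₀ * nuclearDir B U + lam₀ * l1Dir γ β

end MatrixRegression

end

/-!
The argument has a part on matrices, a deterministic part on optimization, and a probabilistic part.

**The nuclear norm.** For orthogonal `P`, `Q` one has `∑ |P_{·i}ᵀ M Q_{·i}| ≤ ‖M‖_*`, with
equality, even without absolute values, when `P`, `Q` come from a singular value decomposition of
`M` (`sum_abs_svdCoord_le_nuclearNorm`, `exists_nuclearNorm_eq_sum_svdCoord`). Hence `‖·‖_*` is a
seminorm, a decomposition of `B` bounds `(‖B + tU‖_* - ‖B‖_*) / t` from below by its `svdTerm`, and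
a decomposition of `B + tU` bounds it from above by `∑ P_{·i}ᵀ U Q_{·i}`. As `t ↓ 0` the latter
decompositions accumulate at decompositions of `B`, so the quotient converges to the supremum of
`svdTerm` (`tendsto_slope_nuclearNorm`).

**Minimizers.** In the coordinate `x = √n ([vec U; β] - [vec B; γ])` the objective becomes, up to
a factor and a constant, `xᵀ S_n x - 2 xᵀ W_n + g_n(x)`, with `S_n` the empirical second moment of
the covariates, `W_n = n^{-1/2} ∑ ε_i [vec X_i; z_i]`, and `g_n` the increment of the two
penalties (`mul_objective_eq`). The `g_n` are uniformly Lipschitz and converge pointwise to the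
penalty part `g₀` of the limiting objective, which is convex as a limit of convex functions.
Positive definiteness of `S` makes the limiting objective strictly convex and coercive, so it has
a unique minimizer `ψ(w)`, and a compactness argument gives both the continuity of `ψ` and the
convergence of the minimizers, uniformly for linear terms in a compact set
(`exists_continuous_minimizer`, `eventually_dist_minimizer_lt`).

**Convergence in distribution.** `W_n` is exactly Gaussian with covariance `σ² S_n`, so it
converges to `N(0, σ² S)` by Lévy's theorem (`tendstoInDistribution_gaussian_score`). It is tight,
so the rescaled estimators differ from `ψ(W_n)` by a term that vanishes in probability, and the
continuous mapping theorem concludes (`tendstoInDistribution_minimizer`). If the penalties are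
`o(√n)`, then `g₀ = 0` and the normal equations give `ψ(w) = S⁻¹ w`.
-/

noncomputable section

namespace MatrixRegression

/-! ### Singular value decompositions and the nuclear norm -/

section SVD

variable {m q : ℕ}

lemma rectDiag_apply (α : Fin (min m q) → ℝ) (i : Fin m) (j : Fin q) :
    rectDiag α i j = ∑ k : Fin (min m q),
      if Fin.castLE (min_le_left m q) k = i ∧ Fin.castLE (min_le_right m q) k = j
        then α k else 0 := by
  simp only [rectDiag, Matrix.of_apply]
  split_ifs with h
  · rw [Finset.sum_eq_single_of_mem
      (⟨i, lt_min i.isLt (h ▸ j.isLt)⟩ : Fin (min m q)) (Finset.mem_univ _)]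
    · rw [if_pos]
      exact ⟨Fin.ext rfl, Fin.ext h⟩
    · intro k _ hk
      rw [if_neg]
      rintro ⟨h1, -⟩
      exact hk (Fin.ext (Fin.ext_iff.1 h1 :))
  · rw [Finset.sum_eq_zero]
    intro k _
    rw [if_neg]
    rintro ⟨h1, h2⟩
    exact h (by rw [← h1, ← h2]; rfl)

lemma mul_rectDiag_mul_apply {m' q' : ℕ} (R : Matrix (Fin m') (Fin m) ℝ)
    (α : Fin (min m q) → ℝ) (T : Matrix (Fin q) (Fin q') ℝ) (a : Fin m') (b : Fin q') :
    (R * rectDiag α * T) a b = ∑ k : Fin (min m q),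
      α k * (R a (Fin.castLE (min_le_left m q) k) * T (Fin.castLE (min_le_right m q) k) b) := by
  simp only [Matrix.mul_apply, rectDiag_apply, Finset.mul_sum, Finset.sum_mul]
  rw [Finset.sum_congr rfl fun j _ => Finset.sum_comm]
  rw [Finset.sum_comm]
  refine Finset.sum_congr rfl fun k _ => ?_
  rw [Finset.sum_eq_single_of_mem (Fin.castLE (min_le_right m q) k) (Finset.mem_univ _),
    Finset.sum_eq_single_of_mem (Fin.castLE (min_le_left m q) k) (Finset.mem_univ _)]
  · simp; ring
  · intro i _ hi
    simp [hi.symm]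
  · intro j _ hj
    refine Finset.sum_eq_zero fun i _ => ?_
    simp [hj.symm]

lemma svdCoord_eq (P : Matrix (Fin m) (Fin m) ℝ) (Q : Matrix (Fin q) (Fin q) ℝ)
    (U : Matrix (Fin m) (Fin q) ℝ) (i : Fin (min m q)) :
    svdCoord P Q U i =
      (Pᵀ * U * Q) (Fin.castLE (min_le_left m q) i) (Fin.castLE (min_le_right m q) i) := by
  rw [Matrix.mul_assoc]
  simp [svdCoord, Matrix.mul_apply, dotProduct, Matrix.mulVec]

lemma svdCoord_add (P : Matrix (Fin m) (Fin m) ℝ) (Q : Matrix (Fin q) (Fin q) ℝ)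
    (U V : Matrix (Fin m) (Fin q) ℝ) (i : Fin (min m q)) :
    svdCoord P Q (U + V) i = svdCoord P Q U i + svdCoord P Q V i := by
  simp [svdCoord, Matrix.add_mulVec]

lemma svdCoord_smul (P : Matrix (Fin m) (Fin m) ℝ) (Q : Matrix (Fin q) (Fin q) ℝ)
    (t : ℝ) (U : Matrix (Fin m) (Fin q) ℝ) (i : Fin (min m q)) :
    svdCoord P Q (t • U) i = t * svdCoord P Q U i := by
  simp [svdCoord, Matrix.smul_mulVec]

lemma sum_sq_row_le_one {n k : ℕ} (hk : k ≤ n) {R : Matrix (Fin n) (Fin n) ℝ}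
    (hR : R ∈ Matrix.orthogonalGroup (Fin n) ℝ) (a : Fin n) :
    ∑ i : Fin k, R a (Fin.castLE hk i) ^ 2 ≤ 1 := by
  have h1 : (R * Rᵀ) a a = 1 := by
    rw [(Matrix.mem_orthogonalGroup_iff _ _).1 hR, Matrix.one_apply_eq]
  rw [← h1, Matrix.mul_apply]
  simp only [Matrix.transpose_apply, ← sq]
  calc ∑ i : Fin k, R a (Fin.castLE hk i) ^ 2
      = ∑ j ∈ Finset.univ.map (Fin.castLEEmb hk), R a j ^ 2 := by simp
    _ ≤ ∑ j, R a j ^ 2 :=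
        Finset.sum_le_sum_of_subset_of_nonneg (Finset.subset_univ _) fun _ _ _ => sq_nonneg _

lemma transpose_mem_orthogonalGroup {n : ℕ} {R : Matrix (Fin n) (Fin n) ℝ}
    (hR : R ∈ Matrix.orthogonalGroup (Fin n) ℝ) : Rᵀ ∈ Matrix.orthogonalGroup (Fin n) ℝ := by
  rw [Matrix.mem_orthogonalGroup_iff, Matrix.transpose_transpose]
  exact (Matrix.mem_orthogonalGroup_iff' _ _).1 hR

/-- Duality for the nuclear norm. The `k`-th summand `α k * R i k * T k i` contributes at most `α k`
to the sum over `i` because the columns of `R` and the rows of `T` are unit vectors. -/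
lemma sum_abs_svdCoord_le {P₀ P : Matrix (Fin m) (Fin m) ℝ} {Q₀ Q : Matrix (Fin q) (Fin q) ℝ}
    {α : Fin (min m q) → ℝ} (hα : ∀ i, 0 ≤ α i)
    (hP₀ : P₀ ∈ Matrix.orthogonalGroup (Fin m) ℝ) (hQ₀ : Q₀ ∈ Matrix.orthogonalGroup (Fin q) ℝ)
    (hP : P ∈ Matrix.orthogonalGroup (Fin m) ℝ) (hQ : Q ∈ Matrix.orthogonalGroup (Fin q) ℝ) :
    ∑ i, |svdCoord P Q (P₀ * rectDiag α * Q₀ᵀ) i| ≤ ∑ i, α i := by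
  have hR : P₀ᵀ * P ∈ Matrix.orthogonalGroup (Fin m) ℝ :=
    mul_mem (transpose_mem_orthogonalGroup hP₀) hP
  have hT : Q₀ᵀ * Q ∈ Matrix.orthogonalGroup (Fin q) ℝ :=
    mul_mem (transpose_mem_orthogonalGroup hQ₀) hQ
  set R := P₀ᵀ * P with hRdef
  set T := Q₀ᵀ * Q with hTdef
  have key : ∀ i, svdCoord P Q (P₀ * rectDiag α * Q₀ᵀ) i = ∑ k, α k *
      (R (Fin.castLE (min_le_left m q) k) (Fin.castLE (min_le_left m q) i) *
        T (Fin.castLE (min_le_right m q) k) (Fin.castLE (min_le_right m q) i)) := by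
    intro i
    have : Pᵀ * (P₀ * rectDiag α * Q₀ᵀ) * Q = Rᵀ * rectDiag α * T := by
      simp only [hRdef, hTdef, Matrix.transpose_mul, Matrix.transpose_transpose, Matrix.mul_assoc]
    rw [svdCoord_eq, this, mul_rectDiag_mul_apply]
    rfl
  calc ∑ i, |svdCoord P Q (P₀ * rectDiag α * Q₀ᵀ) i|
      ≤ ∑ i, ∑ k, α k *
        ((R (Fin.castLE (min_le_left m q) k) (Fin.castLE (min_le_left m q) i) ^ 2 +
          T (Fin.castLE (min_le_right m q) k) (Fin.castLE (min_le_right m q) i) ^ 2) / 2) := by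
        refine Finset.sum_le_sum fun i _ => ?_
        rw [key]
        refine (Finset.abs_sum_le_sum_abs _ _).trans (Finset.sum_le_sum fun k _ => ?_)
        rw [abs_mul, abs_of_nonneg (hα k)]
        refine mul_le_mul_of_nonneg_left ?_ (hα k)
        set x := R (Fin.castLE (min_le_left m q) k) (Fin.castLE (min_le_left m q) i)
        set z := T (Fin.castLE (min_le_right m q) k) (Fin.castLE (min_le_right m q) i)
        rw [abs_le]
        constructor <;> nlinarith [sq_nonneg (x + z), sq_nonneg (x - z)]
    _ = ∑ k, α k *
        ((∑ i, R (Fin.castLE (min_le_left m q) k) (Fin.castLE (min_le_left m q) i) ^ 2 +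
          ∑ i, T (Fin.castLE (min_le_right m q) k) (Fin.castLE (min_le_right m q) i) ^ 2) / 2) := by
        rw [Finset.sum_comm]
        refine Finset.sum_congr rfl fun k _ => ?_
        rw [← Finset.mul_sum, ← Finset.sum_div, Finset.sum_add_distrib]
    _ ≤ ∑ k, α k := by
        refine Finset.sum_le_sum fun k _ => ?_
        have h1 := sum_sq_row_le_one (min_le_left m q) hR (Fin.castLE (min_le_left m q) k)
        have h2 := sum_sq_row_le_one (min_le_right m q) hT (Fin.castLE (min_le_right m q) k)
        exact mul_le_of_le_one_right (hα k) (by linarith)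

lemma svdCoord_self {P : Matrix (Fin m) (Fin m) ℝ} {Q : Matrix (Fin q) (Fin q) ℝ}
    (α : Fin (min m q) → ℝ)
    (hP : P ∈ Matrix.orthogonalGroup (Fin m) ℝ) (hQ : Q ∈ Matrix.orthogonalGroup (Fin q) ℝ)
    (i : Fin (min m q)) : svdCoord P Q (P * rectDiag α * Qᵀ) i = α i := by
  have : Pᵀ * (P * rectDiag α * Qᵀ) * Q = rectDiag α := by
    have h1 := (Matrix.mem_orthogonalGroup_iff' _ _).1 hP
    have h2 := (Matrix.mem_orthogonalGroup_iff' _ _).1 hQ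
    calc _ = (Pᵀ * P) * rectDiag α * (Qᵀ * Q) := by simp only [Matrix.mul_assoc]
      _ = _ := by rw [h1, h2]; simp
  rw [svdCoord_eq, this]
  simp [rectDiag]

/-- The matrix form of the decomposition behind `LinearMap.singularValues`. The right factor is an
eigenbasis of `Mᵀ M`; the left one completes the normalized images of its vectors. -/
lemma exists_svd (M : Matrix (Fin m) (Fin q) ℝ) :
    ∃ P ∈ Matrix.orthogonalGroup (Fin m) ℝ, ∃ Q ∈ Matrix.orthogonalGroup (Fin q) ℝ,
      M = P * rectDiag (m := m) (q := q)
        (fun i => (Matrix.toEuclideanLin M).singularValues (i : ℕ)) * Qᵀ := by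
  classical
  set T := Matrix.toEuclideanLin M with hT
  have hq : Module.finrank ℝ (EuclideanSpace ℝ (Fin q)) = q := by simp
  set v := T.isSymmetric_adjoint_comp_self.eigenvectorBasis hq with hv
  have hinner : ∀ i j : Fin q, inner ℝ (T (v i)) (T (v j)) =
      if i = j then T.singularValues (j : ℕ) ^ 2 else 0 := by
    intro i j
    rw [← LinearMap.adjoint_inner_right, ← LinearMap.comp_apply,
      LinearMap.IsSymmetric.apply_eigenvectorBasis, inner_smul_right,
      T.sq_singularValues_fin hq j]
    simp only [← hv, v.inner_eq_ite]
    simp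
  set f : Fin m → EuclideanSpace ℝ (Fin m) := fun a =>
    if h : (a : ℕ) < q then (T.singularValues (a : ℕ))⁻¹ • T (v ⟨a, h⟩) else 0 with hf
  set s : Set (Fin m) := {a | (a : ℕ) < q ∧ T.singularValues (a : ℕ) ≠ 0} with hs
  have hon : Orthonormal ℝ (s.domRestrict f) := by
    rw [orthonormal_iff_ite]
    rintro ⟨a, ha, ha'⟩ ⟨b, hb, hb'⟩
    simp only [Set.domRestrict_apply, hf, dif_pos ha, dif_pos hb, inner_smul_left,
      inner_smul_right, hinner, Subtype.mk.injEq, Fin.ext_iff]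
    split_ifs with h
    · simp only [h, map_inv₀, conj_trivial]
      field_simp
    · simp
  obtain ⟨u, hu⟩ := hon.exists_orthonormalBasis_extension_of_card_eq (by simp)
  have hTv : ∀ i : Fin (min m q), T (v (Fin.castLE (min_le_right m q) i)) =
      T.singularValues (i : ℕ) • u (Fin.castLE (min_le_left m q) i) := by
    intro i
    by_cases h0 : T.singularValues (i : ℕ) = 0
    · rw [h0, zero_smul, ← inner_self_eq_zero (𝕜 := ℝ), hinner, if_pos rfl]
      simp [h0]
    · have hi : (i : ℕ) < q := i.isLt.trans_le (min_le_right m q)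
      rw [hu _ (show Fin.castLE (min_le_left m q) i ∈ s from ⟨hi, h0⟩)]
      simp only [hf, Fin.val_castLE, dif_pos hi, smul_smul, mul_inv_cancel₀ h0, one_smul]
      rfl
  have hTv0 : ∀ j : Fin q, m ≤ (j : ℕ) → T (v j) = 0 := by
    intro j hj
    have h0 : T.singularValues (j : ℕ) = 0 := by
      rw [T.singularValues_eq_zero_iff_le_finrank_range]
      refine le_trans ?_ hj
      simpa using Submodule.finrank_le T.range
    rw [← inner_self_eq_zero (𝕜 := ℝ), hinner, if_pos rfl]
    simp [h0]
  have horth : ∀ {n : ℕ} (b : OrthonormalBasis (Fin n) ℝ (EuclideanSpace ℝ (Fin n))),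
      (Matrix.of fun i j => b j i) ∈ Matrix.orthogonalGroup (Fin n) ℝ := by
    intro n b
    rw [Matrix.mem_orthogonalGroup_iff']
    ext i j
    have := b.inner_eq_ite i j
    simp only [PiLp.inner_apply, RCLike.inner_apply, conj_trivial] at this
    simp only [Matrix.mul_apply, Matrix.transpose_apply, Matrix.of_apply, Matrix.one_apply]
    rw [← this]
    exact Finset.sum_congr rfl fun _ _ => mul_comm _ _
  refine ⟨_, horth u, _, horth v, ?_⟩
  have hQ := (Matrix.mem_orthogonalGroup_iff _ _).1 (horth v)
  set Q : Matrix (Fin q) (Fin q) ℝ := Matrix.of fun i j => v j i with hQdef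
  set P : Matrix (Fin m) (Fin m) ℝ := Matrix.of fun i j => u j i with hPdef
  set Sg : Matrix (Fin m) (Fin q) ℝ := rectDiag fun i => T.singularValues (i : ℕ) with hSg
  have hMQ : M * Q = P * Sg := by
    ext a j
    have hl : (M * Q) a j = T (v j) a := by
      simp [hT, Matrix.mul_apply, hQdef, Matrix.toLpLin_apply, Matrix.mulVec, dotProduct]
    have hr := mul_rectDiag_mul_apply P (fun i : Fin (min m q) => T.singularValues (i : ℕ))
      (1 : Matrix (Fin q) (Fin q) ℝ) a j
    rw [Matrix.mul_one] at hr
    rw [hl, hSg, hr]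
    by_cases hj : (j : ℕ) < m
    · rw [Finset.sum_eq_single_of_mem (⟨j, lt_min hj j.isLt⟩ : Fin (min m q)) (Finset.mem_univ _)]
      · have := hTv ⟨j, lt_min hj j.isLt⟩
        have hjj : Fin.castLE (min_le_right m q) ⟨j, lt_min hj j.isLt⟩ = j := rfl
        rw [hjj] at this
        rw [this, hjj]
        simp [hPdef]
      · intro k _ hk
        rw [Matrix.one_apply_ne]
        · simp
        · intro h
          exact hk (Fin.ext (Fin.ext_iff.1 h :))
    · rw [hTv0 j (not_lt.1 hj), Finset.sum_eq_zero]
      · rfl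
      · intro k _
        rw [Matrix.one_apply_ne]
        · simp
        · intro h
          exact hj (by rw [← h]; exact k.isLt.trans_le (min_le_left m q))
  calc M = M * (Q * Qᵀ) := by rw [hQ, Matrix.mul_one]
    _ = P * Sg * Qᵀ := by rw [← Matrix.mul_assoc, hMQ]

lemma nuclearNorm_eq_sum (M : Matrix (Fin m) (Fin q) ℝ) :
    nuclearNorm M = ∑ i : Fin (min m q), (Matrix.toEuclideanLin M).singularValues (i : ℕ) := by
  rw [nuclearNorm, Finset.sum_range]

/-- One half of the duality with the spectral norm: pairing `M` with a matrix of spectral norm at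
most one, here `∑ ± P_{·i} Q_{·i}ᵀ`, gives at most `‖M‖_*`. -/
lemma sum_abs_svdCoord_le_nuclearNorm (M : Matrix (Fin m) (Fin q) ℝ)
    {P : Matrix (Fin m) (Fin m) ℝ} {Q : Matrix (Fin q) (Fin q) ℝ}
    (hP : P ∈ Matrix.orthogonalGroup (Fin m) ℝ) (hQ : Q ∈ Matrix.orthogonalGroup (Fin q) ℝ) :
    ∑ i, |svdCoord P Q M i| ≤ nuclearNorm M := by
  obtain ⟨P₀, hP₀, Q₀, hQ₀, h⟩ := exists_svd M
  rw [nuclearNorm_eq_sum]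
  conv_lhs => rw [h]
  exact sum_abs_svdCoord_le (fun i => LinearMap.singularValues_nonneg _ _) hP₀ hQ₀ hP hQ

/-- The value of the nuclear norm does not depend on the decomposition, nor on the order of the
singular values in it. -/
lemma nuclearNorm_eq_of_svd {P : Matrix (Fin m) (Fin m) ℝ} {Q : Matrix (Fin q) (Fin q) ℝ}
    {α : Fin (min m q) → ℝ} (hα : ∀ i, 0 ≤ α i)
    (hP : P ∈ Matrix.orthogonalGroup (Fin m) ℝ) (hQ : Q ∈ Matrix.orthogonalGroup (Fin q) ℝ) :
    nuclearNorm (P * rectDiag α * Qᵀ) = ∑ i, α i := by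
  apply le_antisymm
  · obtain ⟨P₀, hP₀, Q₀, hQ₀, h⟩ := exists_svd (P * rectDiag α * Qᵀ)
    have h1 := sum_abs_svdCoord_le hα hP hQ hP₀ hQ₀
    refine le_trans (le_of_eq ?_) h1
    rw [nuclearNorm_eq_sum]
    refine Finset.sum_congr rfl fun i _ => ?_
    have h2 := svdCoord_self
      (fun i => (Matrix.toEuclideanLin (P * rectDiag α * Qᵀ)).singularValues (i : ℕ)) hP₀ hQ₀ i
    rw [← h] at h2
    rw [h2, abs_of_nonneg (LinearMap.singularValues_nonneg _ _)]
  · have h1 := sum_abs_svdCoord_le_nuclearNorm (P * rectDiag α * Qᵀ) hP hQ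
    refine le_trans (le_of_eq ?_) h1
    refine Finset.sum_congr rfl fun i _ => ?_
    rw [svdCoord_self α hP hQ, abs_of_nonneg (hα i)]

/-- The nuclear norm is attained in the duality `sum_abs_svdCoord_le_nuclearNorm`. -/
lemma exists_nuclearNorm_eq_sum_svdCoord (M : Matrix (Fin m) (Fin q) ℝ) :
    ∃ P ∈ Matrix.orthogonalGroup (Fin m) ℝ, ∃ Q ∈ Matrix.orthogonalGroup (Fin q) ℝ,
      nuclearNorm M = ∑ i, svdCoord P Q M i := by
  obtain ⟨P, hP, Q, hQ, h⟩ := exists_svd M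
  refine ⟨P, hP, Q, hQ, ?_⟩
  rw [nuclearNorm_eq_sum]
  refine Finset.sum_congr rfl fun i _ => ?_
  have h2 := svdCoord_self
    (fun i => (Matrix.toEuclideanLin M).singularValues (i : ℕ)) hP hQ i
  rw [← h] at h2
  exact h2.symm

lemma nuclearNorm_add_le (M N : Matrix (Fin m) (Fin q) ℝ) :
    nuclearNorm (M + N) ≤ nuclearNorm M + nuclearNorm N := by
  obtain ⟨P, hP, Q, hQ, h⟩ := exists_nuclearNorm_eq_sum_svdCoord (M + N)
  rw [h]
  simp only [svdCoord_add, Finset.sum_add_distrib]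
  exact add_le_add
    ((Finset.sum_le_sum fun i _ => le_abs_self _).trans (sum_abs_svdCoord_le_nuclearNorm M hP hQ))
    ((Finset.sum_le_sum fun i _ => le_abs_self _).trans (sum_abs_svdCoord_le_nuclearNorm N hP hQ))

lemma nuclearNorm_smul_le (t : ℝ) (M : Matrix (Fin m) (Fin q) ℝ) :
    nuclearNorm (t • M) ≤ ‖t‖ * nuclearNorm M := by
  obtain ⟨P, hP, Q, hQ, h⟩ := exists_nuclearNorm_eq_sum_svdCoord (t • M)
  rw [h]
  refine le_trans ?_ (mul_le_mul_of_nonneg_left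
    (sum_abs_svdCoord_le_nuclearNorm M hP hQ) (norm_nonneg t))
  rw [Finset.mul_sum]
  refine Finset.sum_le_sum fun i _ => ?_
  rw [svdCoord_smul, Real.norm_eq_abs, ← abs_mul]
  exact le_abs_self _

lemma nuclearNorm_zero : nuclearNorm (0 : Matrix (Fin m) (Fin q) ℝ) = 0 := by
  simp [nuclearNorm]

lemma transpose_rectDiag_mul_self (α : Fin (min m q) → ℝ) :
    (rectDiag α)ᵀ * rectDiag α = Matrix.diagonal fun j : Fin q =>
      if h : (j : ℕ) < min m q then α ⟨j, h⟩ ^ 2 else 0 := by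
  ext i j
  rw [Matrix.mul_apply, Matrix.diagonal_apply]
  simp only [Matrix.transpose_apply, rectDiag, Matrix.of_apply]
  by_cases hi : (i : ℕ) < m
  · rw [Finset.sum_eq_single_of_mem (⟨i, hi⟩ : Fin m) (Finset.mem_univ _)]
    · have hi' : (i : ℕ) < min m q := lt_min hi i.isLt
      by_cases hij : i = j
      · subst hij
        simp only [dif_pos hi', if_true, dif_pos, sq]
      · have hij' : (i : ℕ) ≠ j := fun h => hij (Fin.ext h)
        simp [hij, hij']
    · intro b _ hb
      have : (b : ℕ) ≠ i := fun h => hb (Fin.ext h)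
      simp [this]
  · rw [Finset.sum_eq_zero]
    · have : ¬ (i : ℕ) < min m q := fun h => hi (h.trans_le (min_le_left _ _))
      simp [this]
    · intro b _
      have : (b : ℕ) ≠ i := by have := b.isLt; omega
      simp [this]

lemma rank_svd {P : Matrix (Fin m) (Fin m) ℝ} {Q : Matrix (Fin q) (Fin q) ℝ}
    (α : Fin (min m q) → ℝ)
    (hP : P ∈ Matrix.orthogonalGroup (Fin m) ℝ) (hQ : Q ∈ Matrix.orthogonalGroup (Fin q) ℝ) :
    (P * rectDiag α * Qᵀ).rank = (Finset.univ.filter fun i => α i ≠ 0).card := by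
  have hPu : IsUnit P.det := by
    rw [← Matrix.isUnit_iff_isUnit_det]
    exact ⟨⟨P, Pᵀ, (Matrix.mem_orthogonalGroup_iff _ _).1 hP,
      (Matrix.mem_orthogonalGroup_iff' _ _).1 hP⟩, rfl⟩
  have hQu : IsUnit Qᵀ.det := by
    rw [← Matrix.isUnit_iff_isUnit_det]
    exact ⟨⟨Qᵀ, Q, (Matrix.mem_orthogonalGroup_iff' _ _).1 hQ,
      (Matrix.mem_orthogonalGroup_iff _ _).1 hQ⟩, rfl⟩
  rw [Matrix.rank_mul_eq_left_of_isUnit_det _ _ hQu,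
    Matrix.rank_mul_eq_right_of_isUnit_det _ _ hPu, ← Matrix.rank_transpose_mul_self,
    transpose_rectDiag_mul_self, Matrix.rank_diagonal, Fintype.card_subtype]
  symm
  refine Finset.card_bij (fun i _ => Fin.castLE (min_le_right m q) i) ?_ ?_ ?_
  · intro i hi
    have := i.isLt
    simp only [Finset.mem_filter, Finset.mem_univ, true_and] at hi
    simpa [lt_min_iff.1 this] using hi
  · intro i _ j _ h
    exact Fin.castLE_injective _ h
  · intro j hj
    simp only [Finset.mem_filter, Finset.mem_univ, true_and, ne_eq, dite_eq_right_iff,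
      not_forall] at hj
    obtain ⟨h, hj⟩ := hj
    exact ⟨⟨j, h⟩, by simpa using hj, rfl⟩

/-- A decomposition with nonnegative decreasing diagonal vanishes exactly beyond the rank. -/
lemma isSVD_of_eq {B : Matrix (Fin m) (Fin q) ℝ}
    {P : Matrix (Fin m) (Fin m) ℝ} {Q : Matrix (Fin q) (Fin q) ℝ}
    {α : Fin (min m q) → ℝ} (hα : ∀ i, 0 ≤ α i) (hanti : Antitone α)
    (hP : P ∈ Matrix.orthogonalGroup (Fin m) ℝ) (hQ : Q ∈ Matrix.orthogonalGroup (Fin q) ℝ)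
    (hB : B = P * rectDiag α * Qᵀ) : IsSVD B P α Q := by
  have hr : B.rank = (Finset.univ.filter fun i => α i ≠ 0).card := by rw [hB, rank_svd α hP hQ]
  -- the support of `α` is an initial segment, so membership can be read off its cardinality
  refine ⟨hP, hQ, hanti, fun i hi => ?_, fun i hi => ?_, hB⟩
  · by_contra hn
    have h0 : α i = 0 := le_antisymm (not_lt.1 hn) (hα i)
    have hsub : (Finset.univ.filter fun j => α j ≠ 0) ⊆ Finset.Iio i := by
      intro j hj
      rw [Finset.mem_Iio]
      by_contra hij
      simp only [Finset.mem_filter, Finset.mem_univ, true_and] at hj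
      exact hj (le_antisymm (h0 ▸ hanti (not_lt.1 hij)) (hα j))
    have := Finset.card_le_card hsub
    rw [Fin.card_Iio] at this
    omega
  · by_contra h0
    have hsub : Finset.Iic i ⊆ (Finset.univ.filter fun j => α j ≠ 0) := by
      intro j hj
      rw [Finset.mem_Iic] at hj
      have h1 : 0 < α i := lt_of_le_of_ne (hα i) (Ne.symm h0)
      simpa using (h1.trans_le (hanti hj)).ne'
    have := Finset.card_le_card hsub
    rw [Fin.card_Iic] at this
    omega

lemma exists_isSVD (B : Matrix (Fin m) (Fin q) ℝ) : ∃ P α Q, IsSVD B P α Q := by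
  obtain ⟨P, hP, Q, hQ, h⟩ := exists_svd B
  exact ⟨P, _, Q, isSVD_of_eq (fun i => LinearMap.singularValues_nonneg _ _)
    (fun i j hij => LinearMap.singularValues_antitone _ hij) hP hQ h⟩

lemma IsSVD.nonneg {B : Matrix (Fin m) (Fin q) ℝ} {P : Matrix (Fin m) (Fin m) ℝ}
    {α : Fin (min m q) → ℝ} {Q : Matrix (Fin q) (Fin q) ℝ} (h : IsSVD B P α Q)
    (i : Fin (min m q)) : 0 ≤ α i := by
  rcases lt_or_ge (i : ℕ) B.rank with hi | hi
  · exact (h.pos i hi).le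
  · exact (h.zero i hi).ge

/-! ### The directional derivative of the nuclear norm -/

/-- Every singular value decomposition of `B` bounds the difference quotient from below, since
`‖B + tU‖_* ≥ ∑ |α_i + t P_{·i}ᵀ U Q_{·i}|`. -/
lemma IsSVD.svdTerm_le {B : Matrix (Fin m) (Fin q) ℝ} {P : Matrix (Fin m) (Fin m) ℝ}
    {α : Fin (min m q) → ℝ} {Q : Matrix (Fin q) (Fin q) ℝ} (h : IsSVD B P α Q)
    (U : Matrix (Fin m) (Fin q) ℝ) {t : ℝ} (ht : 0 < t) :
    svdTerm B.rank P Q U ≤ (nuclearNorm (B + t • U) - nuclearNorm B) / t := by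
  rw [le_div_iff₀ ht]
  have h1 := sum_abs_svdCoord_le_nuclearNorm (B + t • U) h.left_mem h.right_mem
  have h2 : nuclearNorm B = ∑ i, α i := by
    rw [h.eq, nuclearNorm_eq_of_svd h.nonneg h.left_mem h.right_mem]
  have h3 : ∀ i, svdCoord P Q B i = α i := fun i => by
    rw [h.eq, svdCoord_self α h.left_mem h.right_mem]
  have h4 : svdTerm B.rank P Q U * t + ∑ i, α i ≤ ∑ i, |svdCoord P Q (B + t • U) i| := by
    rw [svdTerm, Finset.sum_mul, ← Finset.sum_add_distrib]
    refine Finset.sum_le_sum fun i _ => ?_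
    rw [svdCoord_add, svdCoord_smul, h3]
    split_ifs with hi
    · exact le_trans (le_of_eq (by ring)) (le_abs_self _)
    · rw [h.zero i (not_lt.1 hi), zero_add, add_zero, abs_mul, abs_of_pos ht, mul_comm]
  linarith

/-- A singular value decomposition of `B + tU` bounds the difference quotient from above, since it
computes `‖B + tU‖_*` exactly while it only bounds `‖B‖_*` from below. -/
lemma IsSVD.slope_nuclearNorm_le {B U : Matrix (Fin m) (Fin q) ℝ} {t : ℝ} (ht : 0 < t)
    {P : Matrix (Fin m) (Fin m) ℝ} {α : Fin (min m q) → ℝ} {Q : Matrix (Fin q) (Fin q) ℝ}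
    (h : IsSVD (B + t • U) P α Q) :
    (nuclearNorm (B + t • U) - nuclearNorm B) / t ≤ ∑ i, svdCoord P Q U i := by
  have hn : nuclearNorm (B + t • U) = ∑ i, svdCoord P Q (B + t • U) i := by
    rw [h.eq, nuclearNorm_eq_of_svd h.nonneg h.left_mem h.right_mem]
    exact Finset.sum_congr rfl fun i _ => (svdCoord_self α h.left_mem h.right_mem i).symm
  rw [div_le_iff₀ ht, hn]
  have h1 := sum_abs_svdCoord_le_nuclearNorm B h.left_mem h.right_mem
  have h2 : ∑ i, svdCoord P Q B i ≤ ∑ i, |svdCoord P Q B i| :=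
    Finset.sum_le_sum fun i _ => le_abs_self _
  simp only [svdCoord_add, svdCoord_smul, Finset.sum_add_distrib, ← Finset.mul_sum]
  linarith

lemma isCompact_orthogonalGroup (n : ℕ) :
    IsCompact (Matrix.orthogonalGroup (Fin n) ℝ : Set (Matrix (Fin n) (Fin n) ℝ)) := by
  have hsub : (Matrix.orthogonalGroup (Fin n) ℝ : Set (Matrix (Fin n) (Fin n) ℝ)) ⊆
      Set.univ.pi fun _ => Set.univ.pi fun _ => Set.Icc (-1 : ℝ) 1 := by
    intro R hR i _ j _
    have h1 := sum_sq_row_le_one le_rfl hR i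
    have h2 : R i j ^ 2 ≤ 1 := le_trans
      (Finset.single_le_sum (f := fun k => R i (Fin.castLE le_rfl k) ^ 2)
        (fun _ _ => sq_nonneg _) (Finset.mem_univ j)) h1
    exact abs_le.1 (abs_le_one_iff_mul_self_le_one.2 (by rwa [← sq]))
  refine (isCompact_univ_pi fun _ => isCompact_univ_pi fun _ => isCompact_Icc).of_isClosed_subset
    ?_ hsub
  have : (Matrix.orthogonalGroup (Fin n) ℝ : Set (Matrix (Fin n) (Fin n) ℝ)) =
      {R | R * Rᵀ = 1} := by
    ext R
    exact Matrix.mem_orthogonalGroup_iff _ _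
  rw [this]
  exact isClosed_eq (by fun_prop) continuous_const

lemma continuous_svdCoord (i : Fin (min m q)) :
    Continuous fun x : (Matrix (Fin m) (Fin m) ℝ × Matrix (Fin q) (Fin q) ℝ) ×
      Matrix (Fin m) (Fin q) ℝ => svdCoord x.1.1 x.1.2 x.2 i := by
  simp only [svdCoord_eq]
  fun_prop

lemma continuous_rectDiag : Continuous fun α : Fin (min m q) → ℝ => rectDiag α := by
  refine continuous_matrix fun i j => ?_
  simp only [rectDiag_apply]
  refine continuous_finsetSum _ fun k _ => ?_
  split_ifs
  · exact continuous_apply k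
  · exact continuous_const

lemma continuous_mul_rectDiag_mul_transpose :
    Continuous fun y : (Matrix (Fin m) (Fin m) ℝ × Matrix (Fin q) (Fin q) ℝ) ×
      (Fin (min m q) → ℝ) => y.1.1 * rectDiag y.2 * y.1.2ᵀ := by
  have h : Continuous fun y : (Matrix (Fin m) (Fin m) ℝ × Matrix (Fin q) (Fin q) ℝ) ×
      (Fin (min m q) → ℝ) => rectDiag y.2 := continuous_rectDiag.comp continuous_snd
  exact ((continuous_fst.comp continuous_fst).matrix_mul h).matrix_mul
    (continuous_snd.comp continuous_fst).matrix_transpose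

/-- Singular value decompositions of a convergent sequence of matrices accumulate at a singular
value decomposition of the limit, by compactness of the orthogonal groups. -/
lemma exists_isSVD_of_tendsto {B : Matrix (Fin m) (Fin q) ℝ} {M : ℕ → Matrix (Fin m) (Fin q) ℝ}
    (hM : Tendsto M atTop (𝓝 B)) {P : ℕ → Matrix (Fin m) (Fin m) ℝ}
    {α : ℕ → Fin (min m q) → ℝ} {Q : ℕ → Matrix (Fin q) (Fin q) ℝ}
    (h : ∀ k, IsSVD (M k) (P k) (α k) (Q k)) :
    ∃ P' α' Q', IsSVD B P' α' Q' ∧ ∃ φ : ℕ → ℕ, StrictMono φ ∧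
      ∀ U i, Tendsto (fun k => svdCoord (P (φ k)) (Q (φ k)) U i) atTop
        (𝓝 (svdCoord P' Q' U i)) := by
  have : FirstCountableTopology (Matrix (Fin m) (Fin m) ℝ) :=
    inferInstanceAs (FirstCountableTopology (Fin m → Fin m → ℝ))
  have : FirstCountableTopology (Matrix (Fin q) (Fin q) ℝ) :=
    inferInstanceAs (FirstCountableTopology (Fin q → Fin q → ℝ))
  obtain ⟨⟨P', Q'⟩, ⟨hP', hQ'⟩, φ, hφ, hlim⟩ := ((isCompact_orthogonalGroup m).prod
    (isCompact_orthogonalGroup q)).tendsto_subseq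
      (fun k => (⟨(h k).left_mem, (h k).right_mem⟩ : (P k, Q k) ∈ _ ×ˢ _))
  have hMφ : Tendsto (fun k => M (φ k)) atTop (𝓝 B) := hM.comp hφ.tendsto_atTop
  have hcoord : ∀ k i, svdCoord (P k) (Q k) (M k) i = α k i := by
    intro k i
    rw [(h k).eq, svdCoord_self (α k) (h k).left_mem (h k).right_mem]
  have hPl : Tendsto (fun k => P (φ k)) atTop (𝓝 P') := hlim.fst_nhds
  have hQl : Tendsto (fun k => Q (φ k)) atTop (𝓝 Q') := hlim.snd_nhds
  obtain ⟨α', hα'⟩ : ∃ α', α' = fun i => svdCoord P' Q' B i := ⟨_, rfl⟩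
  have hαlim : ∀ i, Tendsto (fun k => α (φ k) i) atTop (𝓝 (α' i)) := by
    intro i
    have h1 := ((continuous_svdCoord i).tendsto ((P', Q'), B)).comp
      ((hPl.prodMk_nhds hQl).prodMk_nhds hMφ)
    rw [hα']
    exact h1.congr fun k => hcoord (φ k) i
  have hUlim : ∀ U i, Tendsto (fun k => svdCoord (P (φ k)) (Q (φ k)) U i) atTop
      (𝓝 (svdCoord P' Q' U i)) := by
    intro U i
    have h1 := ((continuous_svdCoord i).tendsto ((P', Q'), U)).comp
      ((hPl.prodMk_nhds hQl).prodMk_nhds (tendsto_const_nhds (x := U) (f := atTop)))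
    exact h1
  have hB : B = P' * rectDiag α' * Q'ᵀ := by
    have h1 := (continuous_mul_rectDiag_mul_transpose.tendsto ((P', Q'), α')).comp
      ((hPl.prodMk_nhds hQl).prodMk_nhds (tendsto_pi_nhds.2 hαlim))
    have h2 : Tendsto (fun k => M (φ k)) atTop (𝓝 (P' * rectDiag α' * Q'ᵀ)) :=
      h1.congr fun k => ((h (φ k)).eq).symm
    exact tendsto_nhds_unique hMφ h2
  have hα0 : ∀ i, 0 ≤ α' i := fun i =>
    ge_of_tendsto' (hαlim i) fun k => (h (φ k)).nonneg i
  have hanti : Antitone α' := fun i j hij =>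
    le_of_tendsto_of_tendsto' (hαlim j) (hαlim i) fun k => (h (φ k)).antitone hij
  have hsvd : IsSVD B P' α' Q' := isSVD_of_eq hα0 hanti hP' hQ' hB
  exact ⟨P', α', Q', hsvd, φ, hφ, hUlim⟩

/-- Singular value decompositions of `B` bound the difference quotients from below. From above, a
decomposition of `B + tU` bounds the quotient at `t`, and along a sequence `t ↓ 0` these
decompositions accumulate at a decomposition of `B`. -/
theorem tendsto_slope_nuclearNorm (B U : Matrix (Fin m) (Fin q) ℝ) :
    Tendsto (fun t : ℝ => (nuclearNorm (B + t • U) - nuclearNorm B) / t)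
      (𝓝[>] 0) (𝓝 (nuclearDir B U)) := by
  have hbdd : BddAbove {t : ℝ | ∃ P α Q, IsSVD B P α Q ∧ t = svdTerm B.rank P Q U} := by
    refine ⟨(nuclearNorm (B + (1 : ℝ) • U) - nuclearNorm B) / 1, ?_⟩
    rintro _ ⟨P, α, Q, h, rfl⟩
    exact h.svdTerm_le U one_pos
  have hne : {t : ℝ | ∃ P α Q, IsSVD B P α Q ∧ t = svdTerm B.rank P Q U}.Nonempty := by
    obtain ⟨P, α, Q, h⟩ := exists_isSVD B
    exact ⟨_, P, α, Q, h, rfl⟩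
  have hlow : ∀ t : ℝ, 0 < t →
      nuclearDir B U ≤ (nuclearNorm (B + t • U) - nuclearNorm B) / t := by
    intro t ht
    refine csSup_le hne ?_
    rintro _ ⟨P, α, Q, h, rfl⟩
    exact h.svdTerm_le U ht
  refine tendsto_order.2 ⟨fun a ha => ?_, fun a ha => ?_⟩
  · filter_upwards [self_mem_nhdsWithin] with t ht
    exact ha.trans_le (hlow t ht)
  by_contra hcon
  rw [Filter.not_eventually] at hcon
  obtain ⟨t, ht0, ht⟩ := exists_seq_forall_of_frequently hcon
  have hUlim : Tendsto (fun k => B + t k • U) atTop (𝓝 B) := by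
    simpa using ((ht0.mono_right nhdsWithin_le_nhds).smul_const U).const_add B
  have htpos : ∀ᶠ k in atTop, 0 < t k := ht0.eventually self_mem_nhdsWithin
  choose P α Q hPQ using fun k => exists_isSVD (B + t k • U)
  obtain ⟨P', α', Q', hsvd, φ, hφ, hlim⟩ := exists_isSVD_of_tendsto hUlim hPQ
  have hle : ∑ i, svdCoord P' Q' U i ≤ nuclearDir B U := by
    refine le_trans ?_ (le_csSup hbdd ⟨P', α', Q', hsvd, rfl⟩)
    refine Finset.sum_le_sum fun i _ => ?_
    split_ifs
    · exact le_rfl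
    · exact le_abs_self _
  have hlim2 : Tendsto (fun k => ∑ i, svdCoord (P (φ k)) (Q (φ k)) U i) atTop
      (𝓝 (∑ i, svdCoord P' Q' U i)) := tendsto_finsetSum _ fun i _ => hlim U i
  refine absurd (ha.trans_le (ge_of_tendsto hlim2 ?_)) hle.not_gt
  filter_upwards [hφ.tendsto_atTop.eventually htpos] with k hk
  exact (not_lt.1 (ht (φ k))).trans ((hPQ (φ k)).slope_nuclearNorm_le hk)

end SVD

/-! ### Minimizers of penalized quadratic functions -/

section Minimizers

variable {ι : Type*} [Fintype ι]

/-- The penalized quadratic function `x ↦ xᵀ A x - 2 xᵀ v + g(x)`. -/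
def penalizedQuadratic (A : Matrix ι ι ℝ) (g : EuclideanSpace ℝ ι → ℝ)
    (v x : EuclideanSpace ℝ ι) : ℝ :=
  x.ofLp ⬝ᵥ (A *ᵥ x.ofLp) - 2 * inner ℝ x v + g x

lemma continuous_quadraticForm :
    Continuous fun y : Matrix ι ι ℝ × EuclideanSpace ℝ ι =>
      y.2.ofLp ⬝ᵥ (y.1 *ᵥ y.2.ofLp) := by
  simp only [dotProduct, Matrix.mulVec]
  fun_prop

lemma quadraticForm_smul (A : Matrix ι ι ℝ) (t : ℝ) (x : EuclideanSpace ℝ ι) :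
    (t • x).ofLp ⬝ᵥ (A *ᵥ (t • x).ofLp) = t ^ 2 * (x.ofLp ⬝ᵥ (A *ᵥ x.ofLp)) := by
  simp [Matrix.mulVec_smul]
  ring

lemma quadraticForm_pos {A : Matrix ι ι ℝ} (hA : A.PosDef) {x : EuclideanSpace ℝ ι} (hx : x ≠ 0) :
    0 < x.ofLp ⬝ᵥ (A *ᵥ x.ofLp) := by
  have := hA.dotProduct_mulVec_pos (x := x.ofLp) (by simpa using hx)
  simpa using this

lemma exists_quadraticForm_ge [DecidableEq ι] {A : Matrix ι ι ℝ} (hA : A.PosDef) :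
    ∃ c : ℝ, 0 < c ∧ ∀ x : EuclideanSpace ℝ ι, c * ‖x‖ ^ 2 ≤ x.ofLp ⬝ᵥ (A *ᵥ x.ofLp) := by
  have hcont : Continuous fun x : EuclideanSpace ℝ ι => x.ofLp ⬝ᵥ (A *ᵥ x.ofLp) :=
    continuous_quadraticForm.comp (continuous_const.prodMk continuous_id)
  have hscale : ∀ (c : ℝ), (∀ x ∈ Metric.sphere (0 : EuclideanSpace ℝ ι) 1,
      c ≤ x.ofLp ⬝ᵥ (A *ᵥ x.ofLp)) → ∀ x : EuclideanSpace ℝ ι,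
      c * ‖x‖ ^ 2 ≤ x.ofLp ⬝ᵥ (A *ᵥ x.ofLp) := by
    intro c hc x
    by_cases hx : x = 0
    · simp [hx]
    · have hn : ‖x‖ ≠ 0 := norm_ne_zero_iff.2 hx
      have h1 := hc (‖x‖⁻¹ • x) (by simp [norm_smul, hn])
      rw [quadraticForm_smul, inv_pow, ← div_eq_inv_mul, le_div_iff₀ (by positivity)] at h1
      exact h1
  rcases (Metric.sphere (0 : EuclideanSpace ℝ ι) 1).eq_empty_or_nonempty with he | hne
  · exact ⟨1, one_pos, hscale 1 (by simp [he])⟩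
  · obtain ⟨x₀, hx₀, hmin⟩ := (isCompact_sphere (0 : EuclideanSpace ℝ ι) 1).exists_isMinOn hne
      hcont.continuousOn
    refine ⟨_, quadraticForm_pos hA ?_, hscale _ fun x hx => hmin hx⟩
    rintro rfl
    simp at hx₀

lemma eventually_quadraticForm_ge [DecidableEq ι] {A : ℕ → Matrix ι ι ℝ} {A₀ : Matrix ι ι ℝ}
    (hA : Tendsto A atTop (𝓝 A₀)) (hA₀ : A₀.PosDef) :
    ∃ c : ℝ, 0 < c ∧ ∀ᶠ n in atTop, ∀ x : EuclideanSpace ℝ ι,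
      c * ‖x‖ ^ 2 ≤ x.ofLp ⬝ᵥ (A n *ᵥ x.ofLp) := by
  obtain ⟨c, hc, hcA⟩ := exists_quadraticForm_ge hA₀
  have hsum : Tendsto (fun n => ∑ i, ∑ j, |A₀ i j - A n i j|) atTop (𝓝 0) := by
    have h1 : ∀ i j, Tendsto (fun n => |A₀ i j - A n i j|) atTop (𝓝 0) := by
      intro i j
      have h2 : Tendsto (fun n => A n i j) atTop (𝓝 (A₀ i j)) :=
        tendsto_pi_nhds.1 (tendsto_pi_nhds.1 hA i) j
      simpa using (h2.const_sub (A₀ i j)).abs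
    simpa using tendsto_finsetSum Finset.univ fun i _ =>
      tendsto_finsetSum Finset.univ fun j _ => h1 i j
  refine ⟨c / 2, half_pos hc, ?_⟩
  filter_upwards [hsum.eventually (ge_mem_nhds (half_pos hc))] with n hn x
  have h1 : x.ofLp ⬝ᵥ (A₀ *ᵥ x.ofLp) - x.ofLp ⬝ᵥ (A n *ᵥ x.ofLp) ≤ c / 2 * ‖x‖ ^ 2 := by
    calc x.ofLp ⬝ᵥ (A₀ *ᵥ x.ofLp) - x.ofLp ⬝ᵥ (A n *ᵥ x.ofLp)
        = ∑ i, ∑ j, x i * ((A₀ i j - A n i j) * x j) := by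
          rw [← dotProduct_sub, ← Matrix.sub_mulVec]
          simp [dotProduct, Matrix.mulVec, Finset.mul_sum]
      _ ≤ ∑ i, ∑ j, |A₀ i j - A n i j| * ‖x‖ ^ 2 := by
          refine Finset.sum_le_sum fun i _ => Finset.sum_le_sum fun j _ => ?_
          have hi : |x i| ≤ ‖x‖ := PiLp.norm_apply_le x i
          have hj : |x j| ≤ ‖x‖ := PiLp.norm_apply_le x j
          calc x i * ((A₀ i j - A n i j) * x j) ≤ |x i * ((A₀ i j - A n i j) * x j)| :=
                le_abs_self _
            _ = |A₀ i j - A n i j| * (|x i| * |x j|) := by rw [abs_mul, abs_mul]; ring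
            _ ≤ |A₀ i j - A n i j| * ‖x‖ ^ 2 := by
                rw [sq]; gcongr
      _ = (∑ i, ∑ j, |A₀ i j - A n i j|) * ‖x‖ ^ 2 := by simp only [Finset.sum_mul]
      _ ≤ c / 2 * ‖x‖ ^ 2 := by gcongr
  linarith [hcA x]

lemma penalizedQuadratic_zero (A : Matrix ι ι ℝ) {g : EuclideanSpace ℝ ι → ℝ} (hg : g 0 = 0)
    (v : EuclideanSpace ℝ ι) : penalizedQuadratic A g v 0 = 0 := by
  simp [penalizedQuadratic, hg]

/-- A penalized quadratic function is coercive when its penalty decreases at most linearly. -/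
lemma le_penalizedQuadratic {A : Matrix ι ι ℝ} {g : EuclideanSpace ℝ ι → ℝ} {c K : ℝ}
    {x : EuclideanSpace ℝ ι} (hc : c * ‖x‖ ^ 2 ≤ x.ofLp ⬝ᵥ (A *ᵥ x.ofLp)) (hg : |g x| ≤ K * ‖x‖)
    (v : EuclideanSpace ℝ ι) :
    ‖x‖ * (c * ‖x‖ - (2 * ‖v‖ + K)) ≤ penalizedQuadratic A g v x := by
  have h1 := (abs_le.1 hg).1
  have h2 := real_inner_le_norm x v
  rw [penalizedQuadratic]
  nlinarith

/-- Stability of the minimizer: under convergence of the data and pointwise convergence of uniformly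
Lipschitz penalties, the minimizers are bounded, and every cluster point of them minimizes the
limiting function. -/
theorem tendsto_minimizer [DecidableEq ι] {A : ℕ → Matrix ι ι ℝ} {A₀ : Matrix ι ι ℝ}
    (hA : Tendsto A atTop (𝓝 A₀)) (hA₀ : A₀.PosDef)
    {g : ℕ → EuclideanSpace ℝ ι → ℝ} {g₀ : EuclideanSpace ℝ ι → ℝ} {K : ℝ}
    (hLip : ∀ n x y, |g n x - g n y| ≤ K * ‖x - y‖) (hzero : ∀ n, g n 0 = 0)
    (hg : ∀ x, Tendsto (fun n => g n x) atTop (𝓝 (g₀ x)))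
    {v x : ℕ → EuclideanSpace ℝ ι} {v₀ x₀ : EuclideanSpace ℝ ι} (hv : Tendsto v atTop (𝓝 v₀))
    (hx : ∀ n u, penalizedQuadratic (A n) (g n) (v n) (x n) ≤
      penalizedQuadratic (A n) (g n) (v n) u)
    (huniq : ∀ y, (∀ u, penalizedQuadratic A₀ g₀ v₀ y ≤ penalizedQuadratic A₀ g₀ v₀ u) →
      y = x₀) :
    Tendsto x atTop (𝓝 x₀) := by
  obtain ⟨c, hc, hcA⟩ := eventually_quadraticForm_ge hA hA₀
  have hbdd : ∀ᶠ n in atTop, x n ∈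
      Metric.closedBall (0 : EuclideanSpace ℝ ι) (max 0 ((2 * (‖v₀‖ + 1) + K) / c)) := by
    filter_upwards [hcA, hv.norm.eventually (ge_mem_nhds (lt_add_one ‖v₀‖))] with n hn hvn
    rw [mem_closedBall_zero_iff]
    rcases eq_or_lt_of_le (norm_nonneg (x n)) with h0 | h0
    · rw [← h0]; exact le_max_left _ _
    · refine le_trans ?_ (le_max_right _ _)
      rw [le_div_iff₀ hc]
      have h1 := le_penalizedQuadratic (hn (x n))
        (by simpa [hzero n] using hLip n (x n) 0) (v n)
      have h2 := h1.trans ((hx n 0).trans_eq (penalizedQuadratic_zero _ (hzero n) _))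
      have h3 : c * ‖x n‖ - (2 * ‖v n‖ + K) ≤ 0 := by
        by_contra hcon
        exact absurd h2 (not_le.2 (mul_pos h0 (not_le.1 hcon)))
      linarith
  refine (isCompact_closedBall _ _).tendsto_nhds_of_unique_mapClusterPt hbdd fun y _ hy => ?_
  obtain ⟨φ, hφ, hlim⟩ := MapClusterPt.tendsto_subseq hy
  refine huniq y fun u => ?_
  have hφt := hφ.tendsto_atTop
  have hval : ∀ (z : ℕ → EuclideanSpace ℝ ι) (z₀ : EuclideanSpace ℝ ι),
      Tendsto z atTop (𝓝 z₀) → Tendsto (fun k =>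
        penalizedQuadratic (A (φ k)) (g (φ k)) (v (φ k)) (z k)) atTop
        (𝓝 (penalizedQuadratic A₀ g₀ v₀ z₀)) := by
    intro z z₀ hz
    have h1 := (continuous_quadraticForm.tendsto (A₀, z₀)).comp
      ((hA.comp hφt).prodMk_nhds hz)
    have h2 : Tendsto (fun k => inner ℝ (z k) (v (φ k))) atTop (𝓝 (inner ℝ z₀ v₀)) :=
      hz.inner (hv.comp hφt)
    have h3 : Tendsto (fun k => g (φ k) (z k) - g (φ k) z₀) atTop (𝓝 0) := by
      have h4 : Tendsto (fun k => K * ‖z k - z₀‖) atTop (𝓝 0) := by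
        simpa using ((hz.sub_const z₀).norm).const_mul K
      exact squeeze_zero_norm (fun k => hLip (φ k) (z k) z₀) h4
    have h5 : Tendsto (fun k => g (φ k) (z k)) atTop (𝓝 (g₀ z₀)) := by
      simpa using h3.add ((hg z₀).comp hφt)
    exact (h1.sub (h2.const_mul 2)).add h5
  exact le_of_tendsto_of_tendsto' (hval _ _ hlim) (hval _ _ tendsto_const_nhds)
    fun k => hx (φ k) u

lemma exists_minimizer [DecidableEq ι] {A : Matrix ι ι ℝ} (hA : A.PosDef)
    {g : EuclideanSpace ℝ ι → ℝ} {K : ℝ} (hLip : ∀ x y, |g x - g y| ≤ K * ‖x - y‖)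
    (hzero : g 0 = 0) (v : EuclideanSpace ℝ ι) :
    ∃ x, ∀ u, penalizedQuadratic A g v x ≤ penalizedQuadratic A g v u := by
  obtain ⟨c, hc, hcA⟩ := exists_quadraticForm_ge hA
  have hgc : Continuous g := by
    refine continuous_iff_continuousAt.2 fun x => tendsto_iff_norm_sub_tendsto_zero.2 ?_
    have h4 : Tendsto (fun y => K * ‖y - x‖) (𝓝 x) (𝓝 0) := by
      have : Continuous fun y : EuclideanSpace ℝ ι => K * ‖y - x‖ := by fun_prop
      simpa using this.tendsto x
    exact squeeze_zero (fun _ => norm_nonneg _) (fun y => hLip y x) h4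
  have hcont : Continuous (penalizedQuadratic A g v) := by
    have h1 : Continuous fun x : EuclideanSpace ℝ ι => x.ofLp ⬝ᵥ (A *ᵥ x.ofLp) :=
      continuous_quadraticForm.comp (continuous_const.prodMk continuous_id)
    exact (h1.sub (continuous_const.mul (continuous_id.inner continuous_const))).add hgc
  refine hcont.exists_forall_le ?_
  have h1 : Tendsto (fun r : ℝ => r * (c * r - (2 * ‖v‖ + K))) atTop atTop :=
    tendsto_id.atTop_mul_atTop₀
      (tendsto_atTop_add_const_right _ _ (tendsto_id.const_mul_atTop hc))
  refine tendsto_atTop_mono (fun x => ?_) (h1.comp (tendsto_norm_cocompact_atTop))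
  exact le_penalizedQuadratic (hcA x) (by simpa [hzero] using hLip x 0) v

/-- The parallelogram identity makes a penalized quadratic function with convex penalty strictly
convex. -/
lemma minimizer_unique {A : Matrix ι ι ℝ} (hA : A.PosDef) {g : EuclideanSpace ℝ ι → ℝ}
    (hconv : ConvexOn ℝ Set.univ g) {v x y : EuclideanSpace ℝ ι}
    (hx : ∀ u, penalizedQuadratic A g v x ≤ penalizedQuadratic A g v u)
    (hy : ∀ u, penalizedQuadratic A g v y ≤ penalizedQuadratic A g v u) : x = y := by
  by_contra hne
  have hpos := quadraticForm_pos hA (sub_ne_zero.2 hne)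
  have h1 := hx ((1 / 2 : ℝ) • x + (1 / 2 : ℝ) • y)
  have h2 := hy ((1 / 2 : ℝ) • x + (1 / 2 : ℝ) • y)
  have h3 := hconv.2 (Set.mem_univ x) (Set.mem_univ y) (show (0 : ℝ) ≤ 1 / 2 by norm_num)
    (show (0 : ℝ) ≤ 1 / 2 by norm_num) (by norm_num)
  simp only [penalizedQuadratic, WithLp.ofLp_add, WithLp.ofLp_smul, WithLp.ofLp_sub,
    inner_add_left, real_inner_smul_left, Matrix.mulVec_add, Matrix.mulVec_smul,
    Matrix.mulVec_sub, dotProduct_add, add_dotProduct, dotProduct_smul, smul_dotProduct,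
    dotProduct_sub, sub_dotProduct, smul_eq_mul] at h1 h2 h3 hpos
  linarith

/-- The minimizer of a penalized quadratic function with convex Lipschitz penalty, as a continuous
function of the linear term. -/
theorem exists_continuous_minimizer [DecidableEq ι] {A : Matrix ι ι ℝ} (hA : A.PosDef)
    {g : EuclideanSpace ℝ ι → ℝ} {K : ℝ} (hLip : ∀ x y, |g x - g y| ≤ K * ‖x - y‖)
    (hzero : g 0 = 0) (hconv : ConvexOn ℝ Set.univ g) :
    ∃ ψ : EuclideanSpace ℝ ι → EuclideanSpace ℝ ι, Continuous ψ ∧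
      ∀ v x, (∀ u, penalizedQuadratic A g v x ≤ penalizedQuadratic A g v u) ↔ x = ψ v := by
  choose ψ hψ using exists_minimizer hA hLip hzero
  have huniq : ∀ v x, (∀ u, penalizedQuadratic A g v x ≤ penalizedQuadratic A g v u) →
      x = ψ v := fun v x hx => minimizer_unique hA hconv hx (hψ v)
  refine ⟨ψ, ?_, fun v x => ⟨huniq v x, ?_⟩⟩
  · refine continuous_iff_seqContinuous.2 fun v v₀ hv => ?_
    exact tendsto_minimizer tendsto_const_nhds hA (fun _ => hLip) (fun _ => hzero)
      (fun _ => tendsto_const_nhds) hv (fun n => hψ (v n)) (huniq v₀)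
  · rintro rfl
    exact hψ v

/-- Stability of the minimizer, uniformly for linear terms in a compact set. -/
lemma eventually_dist_minimizer_lt [DecidableEq ι] {A : ℕ → Matrix ι ι ℝ} {A₀ : Matrix ι ι ℝ}
    (hA : Tendsto A atTop (𝓝 A₀)) (hA₀ : A₀.PosDef)
    {g : ℕ → EuclideanSpace ℝ ι → ℝ} {g₀ : EuclideanSpace ℝ ι → ℝ} {K : ℝ}
    (hLip : ∀ n x y, |g n x - g n y| ≤ K * ‖x - y‖) (hzero : ∀ n, g n 0 = 0)
    (hg : ∀ x, Tendsto (fun n => g n x) atTop (𝓝 (g₀ x)))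
    {ψ : EuclideanSpace ℝ ι → EuclideanSpace ℝ ι} (hψc : Continuous ψ)
    (hψ : ∀ v x, (∀ u, penalizedQuadratic A₀ g₀ v x ≤ penalizedQuadratic A₀ g₀ v u) → x = ψ v)
    {s : Set (EuclideanSpace ℝ ι)} (hs : IsCompact s) {δ : ℝ} (hδ : 0 < δ) :
    ∀ᶠ n in atTop, ∀ v ∈ s, ∀ x,
      (∀ u, penalizedQuadratic (A n) (g n) v x ≤ penalizedQuadratic (A n) (g n) v u) →
      ‖x - ψ v‖ < δ := by
  by_contra hcon
  obtain ⟨φ, hφ, hbad⟩ := extraction_of_frequently_atTop (not_eventually.1 hcon)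
  push Not at hbad
  choose v hv x hx hdist using hbad
  obtain ⟨v₀, -, κ, hκ, hlim⟩ := hs.tendsto_subseq hv
  have hφκ : Tendsto (fun k => φ (κ k)) atTop atTop := (hφ.comp hκ).tendsto_atTop
  have h1 : Tendsto (fun k => x (κ k)) atTop (𝓝 (ψ v₀)) :=
    tendsto_minimizer (hA.comp hφκ) hA₀ (fun k => hLip (φ (κ k))) (fun k => hzero (φ (κ k)))
      (fun y => (hg y).comp hφκ) hlim (fun k => hx (κ k)) (hψ v₀)
  have h2 : Tendsto (fun k => ‖x (κ k) - ψ (v (κ k))‖) atTop (𝓝 0) := by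
    simpa using (h1.sub ((hψc.tendsto v₀).comp hlim)).norm
  exact absurd (ge_of_tendsto' h2 fun k => hdist (κ k)) (not_le.2 hδ)

/-- The distributional form of the stability of the minimizer: if the linear terms converge in
distribution, then so do the minimizers. By tightness the linear terms may be confined to a compact
set, where the minimizers are uniformly close to those of the limiting function. -/
theorem tendstoInDistribution_minimizer [DecidableEq ι]
    {Ω Ω' : Type*} [MeasurableSpace Ω] {P : Measure Ω} [IsProbabilityMeasure P]
    [MeasurableSpace Ω'] {P' : Measure Ω'} [IsProbabilityMeasure P']
    {A : ℕ → Matrix ι ι ℝ} {A₀ : Matrix ι ι ℝ}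
    (hA : Tendsto A atTop (𝓝 A₀)) (hA₀ : A₀.PosDef)
    {g : ℕ → EuclideanSpace ℝ ι → ℝ} {g₀ : EuclideanSpace ℝ ι → ℝ} {K : ℝ}
    (hLip : ∀ n x y, |g n x - g n y| ≤ K * ‖x - y‖) (hzero : ∀ n, g n 0 = 0)
    (hg : ∀ x, Tendsto (fun n => g n x) atTop (𝓝 (g₀ x)))
    {ψ : EuclideanSpace ℝ ι → EuclideanSpace ℝ ι} (hψc : Continuous ψ)
    (hψ : ∀ v x, (∀ u, penalizedQuadratic A₀ g₀ v x ≤ penalizedQuadratic A₀ g₀ v u) → x = ψ v)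
    {W x : ℕ → Ω → EuclideanSpace ℝ ι} {w : Ω' → EuclideanSpace ℝ ι}
    (hW : TendstoInDistribution W atTop w (fun _ => P) P')
    (hxm : ∀ n, AEMeasurable (x n) P)
    (hx : ∀ᶠ n in atTop, ∀ᵐ ω ∂P, ∀ u,
      penalizedQuadratic (A n) (g n) (W n ω) (x n ω) ≤
        penalizedQuadratic (A n) (g n) (W n ω) u) :
    TendstoInDistribution x atTop (ψ ∘ w) (fun _ => P) P' := by
  refine tendstoInDistribution_of_tendstoInMeasure_sub x _ (hW.continuous_comp hψc) ?_ hxm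
  have hprob : ∀ n, IsProbabilityMeasure (P.map (W n)) := fun n =>
    Measure.isProbabilityMeasure_map (hW.forall_aemeasurable n)
  have htight : IsTightMeasureSet (Set.range fun n => P.map (W n)) := by
    refine isTightMeasureSet_of_tendsto_charFun (f := charFun (P'.map w)) ?_ ?_
    · have := Measure.isProbabilityMeasure_map hW.aemeasurable_limit
      exact continuous_charFun.continuousAt
    · exact ProbabilityMeasure.tendsto_iff_tendsto_charFun.1 hW.tendsto
  rw [tendstoInMeasure_iff_norm]
  intro δ hδ
  refine ENNReal.tendsto_nhds_zero.2 fun η hη => ?_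
  obtain ⟨s, hs, hsW⟩ := isTightMeasureSet_iff_exists_isCompact_measure_compl_le.1 htight η hη
  filter_upwards [hx, eventually_dist_minimizer_lt hA hA₀ hLip hzero hg hψc hψ hs hδ]
    with n hxn hn
  refine le_trans ?_ (hsW _ ⟨n, rfl⟩)
  rw [Measure.map_apply_of_aemeasurable (hW.forall_aemeasurable n) hs.measurableSet.compl]
  refine measure_mono_ae ?_
  filter_upwards [hxn] with ω hω hbad hmem
  have h1 := hn (W n ω) hmem (x n ω) hω
  simp only [Pi.sub_apply, Pi.zero_apply, sub_zero, Function.comp_apply] at hbad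
  exact absurd h1 (not_lt.2 hbad)

end Minimizers

/-! ### Penalties given by seminorms -/

section Penalty

variable {ι : Type*} [Fintype ι]

lemma seminorm_le_mul_norm [DecidableEq ι] (p : Seminorm ℝ (EuclideanSpace ℝ ι)) :
    ∃ C : ℝ, 0 ≤ C ∧ ∀ x, p x ≤ C * ‖x‖ := by
  refine ⟨∑ i, p (EuclideanSpace.single i 1),
    Finset.sum_nonneg fun i _ => apply_nonneg p _, fun x => ?_⟩
  have hx : x = ∑ i, x i • EuclideanSpace.single i (1 : ℝ) := by
    ext j
    simp [Finset.sum_apply, Pi.single_apply]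
  calc p x = p (∑ i, x i • EuclideanSpace.single i (1 : ℝ)) := by rw [← hx]
    _ ≤ ∑ i, p (x i • EuclideanSpace.single i (1 : ℝ)) :=
        Finset.le_sum_of_subadditive p (map_zero p).le (map_add_le_add p) _ _
    _ ≤ ∑ i, p (EuclideanSpace.single i 1) * ‖x‖ := by
        refine Finset.sum_le_sum fun i _ => ?_
        rw [map_smul_eq_mul, mul_comm]
        exact mul_le_mul_of_nonneg_left (PiLp.norm_apply_le x i) (apply_nonneg p _)
    _ = _ := by rw [Finset.sum_mul]

variable {E : Type*} [AddCommGroup E] [Module ℝ E]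

lemma abs_seminorm_add_smul_sub_le (p : Seminorm ℝ E) (b x y : E) {t : ℝ} (ht : 0 ≤ t) :
    |(p (b + t • x) - p b) - (p (b + t • y) - p b)| ≤ t * p (x - y) := by
  have h1 := abs_sub_map_le_sub p (b + t • x) (b + t • y)
  rw [sub_sub_sub_cancel_right]
  refine h1.trans (le_of_eq ?_)
  rw [add_sub_add_left_eq_sub, ← smul_sub, map_smul_eq_mul, Real.norm_of_nonneg ht]

lemma convexOn_directionalDeriv {p : Seminorm ℝ E} {b : E} {d : E → ℝ}
    (hd : ∀ x, Tendsto (fun t : ℝ => (p (b + t • x) - p b) / t) (𝓝[>] 0) (𝓝 (d x))) :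
    ConvexOn ℝ Set.univ d := by
  refine ⟨convex_univ, fun x _ y _ a c ha hc hac => ?_⟩
  refine le_of_tendsto_of_tendsto (hd _) (((hd x).const_smul a).add ((hd y).const_smul c)) ?_
  filter_upwards [self_mem_nhdsWithin] with t ht
  have ht' : (0 : ℝ) < t := ht
  have h1 : p (b + t • (a • x + c • y)) ≤ a * p (b + t • x) + c * p (b + t • y) := by
    have h2 := p.convexOn.2 (Set.mem_univ (b + t • x)) (Set.mem_univ (b + t • y)) ha hc hac
    have h3 : b + t • (a • x + c • y) = a • (b + t • x) + c • (b + t • y) := by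
      nth_rewrite 1 [← one_smul ℝ b]
      rw [← hac]
      module
    rw [h3]
    exact h2
  rw [smul_eq_mul, smul_eq_mul, ← mul_div_assoc, ← mul_div_assoc, ← add_div]
  gcongr
  have h4 : p b = a * p b + c * p b := by rw [← add_mul, hac, one_mul]
  linarith

/-- The increment of the penalty `μ p` at `b` under the perturbation `x / √n`. At `n = 0` the
perturbation is `0`, since `(√0)⁻¹ = 0`. -/
def localPenalty (p : Seminorm ℝ E) (b : E) (μ : ℕ → ℝ) (n : ℕ) (x : E) : ℝ :=
  μ n * (p (b + (√(n : ℝ))⁻¹ • x) - p b)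

lemma localPenalty_zero (p : Seminorm ℝ E) (b : E) (μ : ℕ → ℝ) (n : ℕ) :
    localPenalty p b μ n 0 = 0 := by
  simp [localPenalty]

lemma abs_localPenalty_sub_le (p : Seminorm ℝ E) (b : E) {μ : ℕ → ℝ} {n : ℕ} (hμ : 0 ≤ μ n)
    (x y : E) :
    |localPenalty p b μ n x - localPenalty p b μ n y| ≤ μ n / √(n : ℝ) * p (x - y) := by
  rw [localPenalty, localPenalty, ← mul_sub, abs_mul, abs_of_nonneg hμ, div_eq_mul_inv, mul_assoc]
  exact mul_le_mul_of_nonneg_left (abs_seminorm_add_smul_sub_le p b x y (by positivity)) hμ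

lemma tendsto_localPenalty {p : Seminorm ℝ E} {b x : E} {d μ₀ : ℝ} {μ : ℕ → ℝ}
    (hd : Tendsto (fun t : ℝ => (p (b + t • x) - p b) / t) (𝓝[>] 0) (𝓝 d))
    (hμ : Tendsto (fun n : ℕ => μ n / √(n : ℝ)) atTop (𝓝 μ₀)) :
    Tendsto (fun n => localPenalty p b μ n x) atTop (𝓝 (μ₀ * d)) := by
  have ht : Tendsto (fun n : ℕ => (√(n : ℝ))⁻¹) atTop (𝓝[>] 0) := by
    refine tendsto_inv_atTop_nhdsGT_zero.comp ?_
    exact Real.tendsto_sqrt_atTop.comp tendsto_natCast_atTop_atTop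
  refine (hμ.mul (hd.comp ht)).congr' ?_
  filter_upwards [eventually_gt_atTop 0] with n hn
  have : √(n : ℝ) ≠ 0 := by positivity
  simp only [localPenalty, Function.comp_apply]
  field_simp

end Penalty

/-! ### Gaussian characteristic functions -/

section Gaussian

variable {Ω : Type*} [MeasurableSpace Ω] {P : Measure Ω} {ι : Type*} [Fintype ι]

lemma charFun_map_smul_const {f : Ω → ℝ} (hf : AEMeasurable f P) (u t : EuclideanSpace ℝ ι) :
    charFun (P.map fun ω => f ω • u) t = charFun (P.map f) (inner ℝ u t) := by
  have hm : AEMeasurable (fun ω => f ω • u) P := hf.smul_const u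
  rw [charFun_apply, charFun_apply, integral_map hm (by fun_prop),
    integral_map hf (by fun_prop)]
  simp [real_inner_smul_left, mul_comm]

lemma charFun_map_sum_smul_gaussian [IsProbabilityMeasure P] {ε : ℕ → Ω → ℝ}
    (hindep : iIndepFun ε P) {v : ℝ≥0}
    (hlaw : ∀ i, HasLaw (ε i) (gaussianReal 0 v) P) (s : Finset ℕ)
    (u : ℕ → EuclideanSpace ℝ ι) (t : EuclideanSpace ℝ ι) :
    charFun (P.map fun ω => ∑ i ∈ s, ε i ω • u i) t =
      Complex.exp (-((v * ∑ i ∈ s, inner ℝ (u i) t ^ 2 : ℝ) : ℂ) / 2) := by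
  have hind : iIndepFun (fun i ω => ε i ω • u i) P :=
    hindep.comp (fun i (r : ℝ) => r • u i) fun i => by fun_prop
  rw [iIndepFun.charFun_map_fun_finsetSum_eq_prod (X := fun i ω => ε i ω • u i)
    (fun i _ => (hlaw i).aemeasurable.smul_const (u i)) (hind.restrict s),
    Finset.prod_apply]
  have h1 : ∀ i ∈ s, charFun (P.map fun ω => ε i ω • u i) t =
      Complex.exp (-((v * inner ℝ (u i) t ^ 2 : ℝ) : ℂ) / 2) := by
    intro i _
    rw [charFun_map_smul_const (hlaw i).aemeasurable, (hlaw i).map_eq, charFun_gaussianReal]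
    push_cast
    congr 1
    ring
  rw [Finset.prod_congr rfl h1, ← Complex.exp_sum, Finset.mul_sum]
  push_cast
  rw [← Finset.sum_div, Finset.sum_neg_distrib]

variable [DecidableEq ι]

/-- The Gaussian vector with covariance `v n⁻¹ ∑_{i<n} s_i s_iᵀ` converges in distribution when the
second moments of the `s_i` do, by convergence of the characteristic functions. -/
theorem tendstoInDistribution_gaussian_score [IsProbabilityMeasure P]
    {Ω' : Type*} [MeasurableSpace Ω'] {P' : Measure Ω'} [IsProbabilityMeasure P']
    {ε : ℕ → Ω → ℝ} (hindep : iIndepFun ε P) {v : ℝ≥0}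
    (hlaw : ∀ i, HasLaw (ε i) (gaussianReal 0 v) P)
    {s : ℕ → EuclideanSpace ℝ ι} {S : Matrix ι ι ℝ} (hS : S.PosSemidef)
    (hlim : ∀ t : EuclideanSpace ℝ ι, Tendsto
      (fun n : ℕ => 1 / (n : ℝ) * ∑ i ∈ Finset.range n, inner ℝ (s i) t ^ 2) atTop
      (𝓝 (t.ofLp ⬝ᵥ (S *ᵥ t.ofLp))))
    {w : Ω' → EuclideanSpace ℝ ι} (hw : HasLaw w (multivariateGaussian 0 ((v : ℝ) • S)) P') :
    TendstoInDistribution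
      (fun (n : ℕ) ω => ∑ i ∈ Finset.range n, ε i ω • ((√(n : ℝ))⁻¹ • s i))
      atTop w (fun _ => P) P' := by
  have hm : ∀ n : ℕ, AEMeasurable
      (fun ω => ∑ i ∈ Finset.range n, ε i ω • ((√(n : ℝ))⁻¹ • s i)) P := fun n =>
    Finset.aemeasurable_fun_sum _ fun i _ => (hlaw i).aemeasurable.smul_const _
  refine ⟨hm, hw.aemeasurable, ?_⟩
  refine ProbabilityMeasure.tendsto_iff_tendsto_charFun.2 fun t => ?_
  simp only [ProbabilityMeasure.coe_mk]
  rw [hw.map_eq, charFun_multivariateGaussian (hS.smul v.coe_nonneg)]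
  simp only [charFun_map_sum_smul_gaussian hindep hlaw]
  have h1 : Tendsto (fun n : ℕ =>
      (v : ℝ) * ∑ i ∈ Finset.range n, inner ℝ ((√(n : ℝ))⁻¹ • s i) t ^ 2) atTop
      (𝓝 (v * (t.ofLp ⬝ᵥ (S *ᵥ t.ofLp)))) := by
    refine ((hlim t).const_mul (v : ℝ)).congr fun n => ?_
    congr 1
    rw [Finset.mul_sum]
    refine Finset.sum_congr rfl fun i _ => ?_
    rw [real_inner_smul_left, mul_pow, inv_pow, Real.sq_sqrt n.cast_nonneg, one_div]
  have h2 : Continuous fun r : ℝ => Complex.exp (-(r : ℂ) / 2) := by fun_prop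
  have h3 := (h2.tendsto _).comp h1
  simpa [Matrix.smul_mulVec, Function.comp_def, neg_div] using h3

/-- If `w ∼ N(0, v S)`, then `S⁻¹ w ∼ N(0, v S⁻¹)`. -/
lemma hasLaw_inv_mulVec [IsProbabilityMeasure P] {v : ℝ≥0} {S : Matrix ι ι ℝ} (hS : S.PosDef)
    {w : Ω → EuclideanSpace ℝ ι} (hw : HasLaw w (multivariateGaussian 0 ((v : ℝ) • S)) P) :
    HasLaw (fun ω => WithLp.toLp 2 (S⁻¹ *ᵥ (w ω).ofLp))
      (multivariateGaussian 0 ((v : ℝ) • S⁻¹)) P := by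
  have hc : Continuous fun x : EuclideanSpace ℝ ι =>
      (WithLp.toLp 2 (S⁻¹ *ᵥ x.ofLp) : EuclideanSpace ℝ ι) := by fun_prop
  have hm : AEMeasurable (fun ω => (WithLp.toLp 2 (S⁻¹ *ᵥ (w ω).ofLp) : EuclideanSpace ℝ ι)) P :=
    hc.measurable.comp_aemeasurable hw.aemeasurable
  refine ⟨hm, ?_⟩
  have := Measure.isProbabilityMeasure_map hm
  refine Measure.ext_of_charFun (funext fun t => ?_)
  have hsymm : (S⁻¹)ᵀ = S⁻¹ := by
    have := hS.inv.isHermitian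
    rwa [Matrix.IsHermitian, Matrix.conjTranspose_eq_transpose_of_trivial] at this
  have hadj : ∀ x : EuclideanSpace ℝ ι, inner ℝ (WithLp.toLp 2 (S⁻¹ *ᵥ x.ofLp)) t =
      inner ℝ x (WithLp.toLp 2 (S⁻¹ *ᵥ t.ofLp)) := by
    intro x
    simp only [EuclideanSpace.inner_eq_star_dotProduct, star_trivial]
    rw [Matrix.dotProduct_mulVec, ← Matrix.mulVec_transpose, hsymm]
  have h1 : charFun (P.map fun ω => (WithLp.toLp 2 (S⁻¹ *ᵥ (w ω).ofLp) : EuclideanSpace ℝ ι)) t =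
      charFun (P.map w) (WithLp.toLp 2 (S⁻¹ *ᵥ t.ofLp)) := by
    rw [charFun_apply, charFun_apply, integral_map hm (by fun_prop),
      integral_map hw.aemeasurable (by fun_prop)]
    simp only [hadj]
  have hdet : IsUnit S.det := (Matrix.isUnit_iff_isUnit_det _).1 hS.isUnit
  rw [h1, hw.map_eq, charFun_multivariateGaussian (hS.posSemidef.smul v.coe_nonneg),
    charFun_multivariateGaussian (hS.inv.posSemidef.smul v.coe_nonneg)]
  simp only [Matrix.smul_mulVec, Matrix.mulVec_mulVec, Matrix.smul_mul,
    Matrix.mul_nonsing_inv _ hdet, Matrix.one_mulVec, dotProduct_smul, inner_zero_right]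
  rw [dotProduct_comm]

end Gaussian

/-! ### The stacked regression problem -/

section Regression

variable {m q p : ℕ}

/-- The matrix `U` of a stacked vector `[vec U; β]`. -/
def matPart (x : Stacked m q p) : Matrix (Fin m) (Fin q) ℝ :=
  Matrix.of fun i j => x (Sum.inl (j, i))

/-- The vector `β` of a stacked vector `[vec U; β]`. -/
def vecPart (x : Stacked m q p) : Fin p → ℝ := fun k => x (Sum.inr k)

@[simp]
lemma matPart_stack (U : Matrix (Fin m) (Fin q) ℝ) (β : Fin p → ℝ) :
    matPart (stack U β) = U := by
  ext i j
  simp [matPart, stack]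

@[simp]
lemma vecPart_stack (U : Matrix (Fin m) (Fin q) ℝ) (β : Fin p → ℝ) :
    vecPart (stack U β) = β := by
  ext i
  simp [vecPart, stack]

@[simp]
lemma stack_matPart_vecPart (x : Stacked m q p) : stack (matPart x) (vecPart x) = x := by
  ext i
  rcases i with ⟨i, j⟩ | k <;> rfl

lemma matPart_add (x y : Stacked m q p) : matPart (x + y) = matPart x + matPart y := by
  ext; simp [matPart]

lemma vecPart_add (x y : Stacked m q p) : vecPart (x + y) = vecPart x + vecPart y := by
  ext; simp [vecPart]

lemma matPart_smul (t : ℝ) (x : Stacked m q p) : matPart (t • x) = t • matPart x := by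
  ext; simp [matPart]

lemma vecPart_smul (t : ℝ) (x : Stacked m q p) : vecPart (t • x) = t • vecPart x := by
  ext; simp [vecPart]

lemma ofLp_eq_sumElim (x : Stacked m q p) : x.ofLp = Sum.elim (matPart x).vec (vecPart x) := by
  conv_lhs => rw [← stack_matPart_vecPart x]
  rfl

lemma stack_sub (U V : Matrix (Fin m) (Fin q) ℝ) (β η : Fin p → ℝ) :
    stack (U - V) (β - η) = stack U β - stack V η := by
  ext i
  rcases i with ⟨i, j⟩ | k <;> simp [stack]

lemma inner_stack (X : Matrix (Fin m) (Fin q) ℝ) (z : Fin p → ℝ) (x : Stacked m q p) :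
    inner ℝ (stack X z) x = matInner X (matPart x) + z ⬝ᵥ vecPart x := by
  simp only [PiLp.inner_apply, RCLike.inner_apply, conj_trivial, Fintype.sum_sum_type,
    Fintype.sum_prod_type]
  rw [Finset.sum_comm]
  simp [stack, matInner, matPart, vecPart, dotProduct, mul_comm]

/-- The nuclear norm of the matrix part, as a seminorm on stacked vectors. -/
def nuclearSeminorm (m q p : ℕ) : Seminorm ℝ (Stacked m q p) :=
  Seminorm.ofSMulLE (fun x => nuclearNorm (matPart x))
    (by rw [← nuclearNorm_zero]; congr 1)
    (fun x y => by rw [matPart_add]; exact nuclearNorm_add_le _ _)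
    (fun t x => by rw [matPart_smul]; exact nuclearNorm_smul_le _ _)

lemma nuclearSeminorm_apply (x : Stacked m q p) :
    nuclearSeminorm m q p x = nuclearNorm (matPart x) := rfl

/-- The `ℓ₁` norm of the vector part, as a seminorm on stacked vectors. -/
def l1Seminorm (m q p : ℕ) : Seminorm ℝ (Stacked m q p) :=
  Seminorm.of (fun x => l1Norm (vecPart x))
    (fun x y => by
      rw [vecPart_add, l1Norm, l1Norm, l1Norm, ← Finset.sum_add_distrib]
      exact Finset.sum_le_sum fun i _ => abs_add_le _ _)
    (fun t x => by
      rw [vecPart_smul, l1Norm, l1Norm, Finset.mul_sum]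
      exact Finset.sum_congr rfl fun i _ => by simp [abs_mul])

lemma l1Seminorm_apply (x : Stacked m q p) : l1Seminorm m q p x = l1Norm (vecPart x) := rfl

lemma tendsto_slope_abs (a b : ℝ) :
    Tendsto (fun t : ℝ => (|a + t * b| - |a|) / t) (𝓝[>] 0)
      (𝓝 (b * Real.sign a * (if a ≠ 0 then 1 else 0) + |b| * (if a = 0 then 1 else 0))) := by
  have hlim : Tendsto (fun t : ℝ => a + t * b) (𝓝[>] 0) (𝓝 a) := by
    have : Continuous fun t : ℝ => a + t * b := by fun_prop
    exact (by simpa using this.tendsto 0 : Tendsto (fun t : ℝ => a + t * b) (𝓝 0) (𝓝 a)).mono_left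
      nhdsWithin_le_nhds
  refine tendsto_const_nhds.congr' ?_
  rcases lt_trichotomy a 0 with ha | rfl | ha
  · filter_upwards [self_mem_nhdsWithin, hlim.eventually (gt_mem_nhds ha)] with t ht hta
    have ht' : t ≠ 0 := ne_of_gt ht
    rw [abs_of_neg ha, abs_of_neg hta, Real.sign_of_neg ha]
    simp only [ha.ne, ne_eq, not_false_eq_true, if_true, if_false]
    field_simp
    ring
  · filter_upwards [self_mem_nhdsWithin] with t ht
    have ht' : (0 : ℝ) < t := ht
    simp [abs_mul, abs_of_pos ht', ht'.ne']
  · filter_upwards [self_mem_nhdsWithin, hlim.eventually (lt_mem_nhds ha)] with t ht hta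
    have ht' : t ≠ 0 := ne_of_gt ht
    rw [abs_of_pos ha, abs_of_pos hta, Real.sign_of_pos ha]
    simp only [ha.ne', ne_eq, not_false_eq_true, if_true, if_false]
    field_simp
    ring

lemma tendsto_slope_l1Norm (γ β : Fin p → ℝ) :
    Tendsto (fun t : ℝ => (l1Norm (γ + t • β) - l1Norm γ) / t) (𝓝[>] 0) (𝓝 (l1Dir γ β)) := by
  refine (tendsto_finsetSum Finset.univ fun i _ => tendsto_slope_abs (γ i) (β i)).congr fun t => ?_
  simp [l1Norm, ← Finset.sum_div]

/-- The matrix `S_n`, the empirical second moment of the stacked covariates. -/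
def gramS (X : ℕ → Matrix (Fin m) (Fin q) ℝ) (z : ℕ → Fin p → ℝ) (n : ℕ) :
    Matrix (Idx m q p) (Idx m q p) ℝ :=
  blockS (gramC X n) (gramD z n) (gramH X z n)

lemma tendsto_gramS {X : ℕ → Matrix (Fin m) (Fin q) ℝ} {z : ℕ → Fin p → ℝ}
    {C : Matrix (Fin q × Fin m) (Fin q × Fin m) ℝ} {D : Matrix (Fin p) (Fin p) ℝ}
    {H : Matrix (Fin q × Fin m) (Fin p) ℝ} (hC : Tendsto (gramC X) atTop (𝓝 C))
    (hD : Tendsto (gramD z) atTop (𝓝 D)) (hH : Tendsto (gramH X z) atTop (𝓝 H)) :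
    Tendsto (gramS X z) atTop (𝓝 (blockS C D H)) := by
  have hc : Continuous fun y : Matrix (Fin q × Fin m) (Fin q × Fin m) ℝ ×
      Matrix (Fin p) (Fin p) ℝ × Matrix (Fin q × Fin m) (Fin p) ℝ =>
        blockS y.1 y.2.1 y.2.2 := by
    unfold blockS
    fun_prop
  have h1 := (hc.tendsto (C, D, H)).comp (hC.prodMk_nhds (hD.prodMk_nhds hH))
  exact h1

lemma blockS_quadraticForm (C : Matrix (Fin q × Fin m) (Fin q × Fin m) ℝ)
    (D : Matrix (Fin p) (Fin p) ℝ) (H : Matrix (Fin q × Fin m) (Fin p) ℝ) (x : Stacked m q p) :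
    x.ofLp ⬝ᵥ (blockS C D H *ᵥ x.ofLp) =
      (matPart x).vec ⬝ᵥ (C *ᵥ (matPart x).vec) + vecPart x ⬝ᵥ (D *ᵥ vecPart x)
        + 2 * ((matPart x).vec ⬝ᵥ (H *ᵥ vecPart x)) := by
  have h1 : vecPart x ⬝ᵥ (Hᵀ *ᵥ (matPart x).vec) = (matPart x).vec ⬝ᵥ (H *ᵥ vecPart x) := by
    rw [Matrix.mulVec_transpose, dotProduct_comm, Matrix.dotProduct_mulVec]
  rw [ofLp_eq_sumElim, blockS, Matrix.fromBlocks_mulVec]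
  simp only [Sum.elim_comp_inl, Sum.elim_comp_inr, sumElim_dotProduct_sumElim,
    dotProduct_add, h1]
  ring

lemma gramS_quadraticForm (X : ℕ → Matrix (Fin m) (Fin q) ℝ) (z : ℕ → Fin p → ℝ) (n : ℕ)
    (x : Stacked m q p) :
    x.ofLp ⬝ᵥ (gramS X z n *ᵥ x.ofLp) =
      1 / (n : ℝ) * ∑ i ∈ Finset.range n, inner ℝ (stack (X i) (z i)) x ^ 2 := by
  have hX : ∀ i, matInner (X i) (matPart x) = (X i).vec ⬝ᵥ (matPart x).vec := by
    intro i
    simp only [matInner, dotProduct, Fintype.sum_prod_type, Matrix.vec]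
    exact Finset.sum_comm
  rw [gramS, blockS_quadraticForm]
  simp only [gramC, gramD, gramH, Matrix.smul_mulVec, dotProduct_smul, Matrix.sum_mulVec,
    dotProduct_sum, Matrix.vecMulVec_mulVec, smul_eq_mul, inner_stack, hX, op_smul_eq_smul]
  rw [← mul_add, mul_left_comm, ← mul_add, Finset.mul_sum, ← Finset.sum_add_distrib,
    ← Finset.sum_add_distrib]
  congr 1
  refine Finset.sum_congr rfl fun i _ => ?_
  rw [dotProduct_comm (matPart x).vec, dotProduct_comm (vecPart x)]
  ring

lemma limitObjective_eq (C : Matrix (Fin q × Fin m) (Fin q × Fin m) ℝ)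
    (D : Matrix (Fin p) (Fin p) ℝ) (H : Matrix (Fin q × Fin m) (Fin p) ℝ)
    (B : Matrix (Fin m) (Fin q) ℝ) (γ : Fin p → ℝ) (ρ₀ lam₀ : ℝ) (v x : Stacked m q p) :
    limitObjective C D H B γ ρ₀ lam₀ v (matPart x) (vecPart x) =
      penalizedQuadratic (blockS C D H)
        (fun x => ρ₀ * nuclearDir B (matPart x) + lam₀ * l1Dir γ (vecPart x)) v x := by
  have h1 : inner ℝ x v = ((matPart x).vec ⬝ᵥ fun k => v (Sum.inl k)) +
      (vecPart x ⬝ᵥ fun k => v (Sum.inr k)) := by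
    simp only [PiLp.inner_apply, RCLike.inner_apply, conj_trivial, Fintype.sum_sum_type]
    simp [dotProduct, matPart, vecPart, Matrix.vec, mul_comm]
  rw [penalizedQuadratic, blockS_quadraticForm, h1, limitObjective]
  ring

/-- The score `W_n = n^{-1/2} ∑_{i<n} ε_i [vec X_i; z_i]`. -/
def score (X : ℕ → Matrix (Fin m) (Fin q) ℝ) (z : ℕ → Fin p → ℝ) (e : ℕ → ℝ) (n : ℕ) :
    Stacked m q p :=
  ∑ i ∈ Finset.range n, e i • ((√(n : ℝ))⁻¹ • stack (X i) (z i))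

/-- In the local coordinate `x = √n ([vec U; β] - b)` around the true parameter `b`, the objective
is a penalized quadratic function, up to the factor `n` and a constant. -/
lemma mul_objective_eq {X : ℕ → Matrix (Fin m) (Fin q) ℝ} {z : ℕ → Fin p → ℝ}
    {b : Stacked m q p} {y e : ℕ → ℝ}
    (hy : ∀ i, y i = matInner (X i) (matPart b) + z i ⬝ᵥ vecPart b + e i)
    (ρ lam : ℕ → ℝ) {n : ℕ} (hn : n ≠ 0) (x : Stacked m q p) :
    n * objective X z y n (ρ n) (lam n) (matPart (b + (√(n : ℝ))⁻¹ • x))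
        (vecPart (b + (√(n : ℝ))⁻¹ • x)) =
      penalizedQuadratic (gramS X z n)
        (fun x => localPenalty (nuclearSeminorm m q p) b ρ n x +
          localPenalty (l1Seminorm m q p) b lam n x) (score X z e n) x +
      (∑ i ∈ Finset.range n, e i ^ 2 + ρ n * nuclearSeminorm m q p b
        + lam n * l1Seminorm m q p b) := by
  have hn' : (n : ℝ) ≠ 0 := Nat.cast_ne_zero.2 hn
  have hres : ∀ i, y i - matInner (X i) (matPart (b + (√(n : ℝ))⁻¹ • x)) -
      z i ⬝ᵥ vecPart (b + (√(n : ℝ))⁻¹ • x) =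
      e i - (√(n : ℝ))⁻¹ * inner ℝ (stack (X i) (z i)) x := by
    intro i
    have h1 := inner_stack (X i) (z i) (b + (√(n : ℝ))⁻¹ • x)
    have h2 := inner_stack (X i) (z i) b
    rw [inner_add_right, real_inner_smul_right] at h1
    rw [hy i]
    linarith
  have hsq : ((√(n : ℝ))⁻¹) ^ 2 = 1 / (n : ℝ) := by
    rw [inv_pow, Real.sq_sqrt n.cast_nonneg, one_div]
  have hscore : inner ℝ x (score X z e n) =
      ∑ i ∈ Finset.range n, e i * ((√(n : ℝ))⁻¹ * inner ℝ (stack (X i) (z i)) x) := by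
    rw [score, inner_sum]
    refine Finset.sum_congr rfl fun i _ => ?_
    rw [real_inner_smul_right, real_inner_smul_right, real_inner_comm]
  have hsum : ∑ i ∈ Finset.range n, (e i - (√(n : ℝ))⁻¹ * inner ℝ (stack (X i) (z i)) x) ^ 2 =
      ∑ i ∈ Finset.range n, e i ^ 2 - 2 * inner ℝ x (score X z e n) +
        x.ofLp ⬝ᵥ (gramS X z n *ᵥ x.ofLp) := by
    rw [hscore, gramS_quadraticForm, Finset.mul_sum, Finset.mul_sum, ← Finset.sum_sub_distrib,
      ← Finset.sum_add_distrib]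
    refine Finset.sum_congr rfl fun i _ => ?_
    rw [← hsq]
    ring
  simp only [objective, hres, hsum, penalizedQuadratic, localPenalty, nuclearSeminorm_apply,
    l1Seminorm_apply]
  field_simp
  ring

/-- Without penalties the minimizer solves the normal equations. -/
lemma inv_mulVec_minimizes {ι : Type*} [Fintype ι] [DecidableEq ι] {S : Matrix ι ι ℝ}
    (hS : S.PosDef) (v u : EuclideanSpace ℝ ι) :
    penalizedQuadratic S (fun _ => 0) v (WithLp.toLp 2 (S⁻¹ *ᵥ v.ofLp)) ≤
      penalizedQuadratic S (fun _ => 0) v u := by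
  obtain ⟨a, ha⟩ : ∃ a : EuclideanSpace ℝ ι, a = WithLp.toLp 2 (S⁻¹ *ᵥ v.ofLp) := ⟨_, rfl⟩
  have hdet : IsUnit S.det := (Matrix.isUnit_iff_isUnit_det _).1 hS.isUnit
  have hSa : S *ᵥ a.ofLp = v.ofLp := by
    rw [ha, Matrix.mulVec_mulVec, Matrix.mul_nonsing_inv _ hdet, Matrix.one_mulVec]
  have hsymm : Sᵀ = S := by
    have := hS.isHermitian
    rwa [Matrix.IsHermitian, Matrix.conjTranspose_eq_transpose_of_trivial] at this
  have hnn : 0 ≤ (u - a).ofLp ⬝ᵥ (S *ᵥ (u - a).ofLp) := by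
    simpa using hS.posSemidef.dotProduct_mulVec_nonneg (u - a).ofLp
  have haSu : a.ofLp ⬝ᵥ (S *ᵥ u.ofLp) = u.ofLp ⬝ᵥ v.ofLp := by
    rw [Matrix.dotProduct_mulVec, ← Matrix.mulVec_transpose, hsymm, hSa, dotProduct_comm]
  have hin : ∀ x : EuclideanSpace ℝ ι, inner ℝ x v = x.ofLp ⬝ᵥ v.ofLp := by
    intro x
    rw [EuclideanSpace.inner_eq_star_dotProduct, star_trivial, dotProduct_comm]
  simp only [WithLp.ofLp_sub, Matrix.mulVec_sub, dotProduct_sub, sub_dotProduct, hSa, haSu] at hnn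
  rw [← ha]
  simp only [penalizedQuadratic, hin, hSa]
  linarith

end Regression

end MatrixRegression

end

open MatrixRegression

theorem theorem2
    {m q p : ℕ}
    -- true coefficients, design, noise level
    (B : Matrix (Fin m) (Fin q) ℝ) (γ : Fin p → ℝ)
    (X : ℕ → Matrix (Fin m) (Fin q) ℝ) (z : ℕ → Fin p → ℝ) (σ : ℝ≥0)
    -- i.i.d. normal noise with mean `0` and standard deviation `σ`
    {Ω : Type*} [MeasurableSpace Ω] (P : Measure Ω) [IsProbabilityMeasure P]
    (ε : ℕ → Ω → ℝ) (hε_indep : iIndepFun ε P)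
    (hε_law : ∀ i, HasLaw (ε i) (gaussianReal 0 (σ ^ 2)) P)
    -- the linear model
    (y : ℕ → Ω → ℝ)
    (hy : ∀ i ω, y i ω = MatrixRegression.matInner (X i) B + z i ⬝ᵥ γ + ε i ω)
    -- regularity of the design
    (C : Matrix (Fin q × Fin m) (Fin q × Fin m) ℝ) (D : Matrix (Fin p) (Fin p) ℝ)
    (H : Matrix (Fin q × Fin m) (Fin p) ℝ)
    (hC : Tendsto (MatrixRegression.gramC X) atTop (𝓝 C))
    (hD : Tendsto (MatrixRegression.gramD z) atTop (𝓝 D))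
    (hH : Tendsto (MatrixRegression.gramH X z) atTop (𝓝 H))
    (hS : (MatrixRegression.blockS C D H).PosDef)
    -- penalty parameters
    (ρ lam : ℕ → ℝ) (hρ : ∀ n, 0 ≤ ρ n) (hlam : ∀ n, 0 ≤ lam n)
    (ρ₀ lam₀ : ℝ) (hρ₀ : 0 ≤ ρ₀) (hlam₀ : 0 ≤ lam₀)
    (hρ_lim : Tendsto (fun n : ℕ => ρ n / √(n : ℝ)) atTop (𝓝 ρ₀))
    (hlam_lim : Tendsto (fun n : ℕ => lam n / √(n : ℝ)) atTop (𝓝 lam₀))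
    -- the estimators: random minimizers of the penalized least squares objective
    (Bhat : ℕ → Ω → Matrix (Fin m) (Fin q) ℝ) (γhat : ℕ → Ω → Fin p → ℝ)
    (hhat_meas : ∀ n, AEMeasurable (fun ω => MatrixRegression.stack (Bhat n ω) (γhat n ω)) P)
    (hhat : ∀ n, ∀ᵐ ω ∂P, ∀ (U : Matrix (Fin m) (Fin q) ℝ) (β : Fin p → ℝ),
      MatrixRegression.objective X z (fun i => y i ω) n (ρ n) (lam n) (Bhat n ω) (γhat n ω)
        ≤ MatrixRegression.objective X z (fun i => y i ω) n (ρ n) (lam n) U β)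
    -- the Gaussian vector `w = [w₁; w₂] ∼ N(0, σ² S)`
    {Ω' : Type*} [MeasurableSpace Ω'] (P' : Measure Ω') [IsProbabilityMeasure P']
    (w : Ω' → MatrixRegression.Stacked m q p)
    (hw : HasLaw w
      (multivariateGaussian 0 ((σ : ℝ) ^ 2 • MatrixRegression.blockS C D H)) P') :
    -- the nuclear norm part of `F` is the directional derivative of the nuclear norm at `B`
    (∀ U : Matrix (Fin m) (Fin q) ℝ,
      Tendsto (fun t : ℝ =>
          (MatrixRegression.nuclearNorm (B + t • U) - MatrixRegression.nuclearNorm B) / t)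
        (𝓝[>] 0) (𝓝 (MatrixRegression.nuclearDir B U))) ∧
    -- the minimizer of `F` exists, is unique and measurable in `w`, and is the limit in law
    ∃ (Ustar : MatrixRegression.Stacked m q p → Matrix (Fin m) (Fin q) ℝ)
      (βstar : MatrixRegression.Stacked m q p → Fin p → ℝ),
      Measurable (fun v => MatrixRegression.stack (Ustar v) (βstar v)) ∧
      (∀ (v : MatrixRegression.Stacked m q p) (U : Matrix (Fin m) (Fin q) ℝ) (β : Fin p → ℝ),
        (∀ (U' : Matrix (Fin m) (Fin q) ℝ) (β' : Fin p → ℝ),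
          MatrixRegression.limitObjective C D H B γ ρ₀ lam₀ v U β
            ≤ MatrixRegression.limitObjective C D H B γ ρ₀ lam₀ v U' β')
        ↔ U = Ustar v ∧ β = βstar v) ∧
      TendstoInDistribution
        (fun (n : ℕ) (ω : Ω) =>
          √(n : ℝ) • MatrixRegression.stack (Bhat n ω - B) (γhat n ω - γ))
        atTop
        (fun ω' => MatrixRegression.stack (Ustar (w ω')) (βstar (w ω')))
        (fun _ => P) P' ∧
      -- the case of penalties of order `o(√n)`
      (ρ =o[atTop] (fun n : ℕ => √(n : ℝ)) → lam =o[atTop] (fun n : ℕ => √(n : ℝ)) →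
        (∀ v : MatrixRegression.Stacked m q p,
          MatrixRegression.stack (Ustar v) (βstar v)
            = WithLp.toLp 2 ((MatrixRegression.blockS C D H)⁻¹ *ᵥ v.ofLp)) ∧
        HasLaw (fun ω' => MatrixRegression.stack (Ustar (w ω')) (βstar (w ω')))
          (multivariateGaussian 0 ((σ : ℝ) ^ 2 • (MatrixRegression.blockS C D H)⁻¹)) P') := by
  have hdirN : ∀ x : Stacked m q p, Tendsto (fun t : ℝ =>
      (nuclearSeminorm m q p (stack B γ + t • x) -
        nuclearSeminorm m q p (stack B γ)) / t) (𝓝[>] 0)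
      (𝓝 (nuclearDir B (matPart x))) := by
    intro x
    simpa only [nuclearSeminorm_apply, matPart_add,
      matPart_smul, matPart_stack] using
      tendsto_slope_nuclearNorm B (matPart x)
  have hdirL : ∀ x : Stacked m q p, Tendsto (fun t : ℝ =>
      (l1Seminorm m q p (stack B γ + t • x) -
        l1Seminorm m q p (stack B γ)) / t) (𝓝[>] 0)
      (𝓝 (l1Dir γ (vecPart x))) := by
    intro x
    simpa only [l1Seminorm_apply, vecPart_add,
      vecPart_smul, vecPart_stack] using
      tendsto_slope_l1Norm γ (vecPart x)
  have hw' : HasLaw w (multivariateGaussian 0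
      (((σ ^ 2 : ℝ≥0) : ℝ) • blockS C D H)) P' := by
    rw [NNReal.coe_pow]
    exact hw
  refine ⟨tendsto_slope_nuclearNorm B, ?_⟩
  obtain ⟨g₀, hg₀⟩ : ∃ g₀ : Stacked m q p → ℝ, g₀ = fun x =>
      ρ₀ * nuclearDir B (matPart x) +
        lam₀ * l1Dir γ (vecPart x) := ⟨_, rfl⟩
  obtain ⟨g, hg⟩ : ∃ g : ℕ → Stacked m q p → ℝ, g = fun n x =>
      localPenalty (nuclearSeminorm m q p)
        (stack B γ) ρ n x +
      localPenalty (l1Seminorm m q p)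
        (stack B γ) lam n x := ⟨_, rfl⟩
  have hg0 : ∀ n, g n 0 = 0 := fun n => by
    simp [hg, localPenalty_zero]
  have hglim : ∀ x, Tendsto (fun n => g n x) atTop (𝓝 (g₀ x)) := by
    intro x
    simp only [hg, hg₀]
    exact (tendsto_localPenalty (hdirN x) hρ_lim).add
      (tendsto_localPenalty (hdirL x) hlam_lim)
  -- a common Lipschitz constant: the scaled penalty parameters converge, hence are bounded
  obtain ⟨K, hLip⟩ : ∃ K : ℝ, ∀ n x y, |g n x - g n y| ≤ K * ‖x - y‖ := by
    obtain ⟨c₁, hc₁0, hc₁⟩ :=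
      seminorm_le_mul_norm (nuclearSeminorm m q p)
    obtain ⟨c₂, hc₂0, hc₂⟩ :=
      seminorm_le_mul_norm (l1Seminorm m q p)
    obtain ⟨r₁, hr₁⟩ := hρ_lim.bddAbove_range
    obtain ⟨r₂, hr₂⟩ := hlam_lim.bddAbove_range
    refine ⟨r₁ * c₁ + r₂ * c₂, fun n x y => ?_⟩
    have hb : ∀ {μ : ℕ → ℝ} {r c : ℝ} {s : Seminorm ℝ (Stacked m q p)},
        0 ≤ μ n → μ n / √(n : ℝ) ≤ r → (∀ x, s x ≤ c * ‖x‖) →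
        |localPenalty s (stack B γ) μ n x -
          localPenalty s (stack B γ) μ n y| ≤
          r * c * ‖x - y‖ := by
      intro μ r c s hμ hr hc
      refine (abs_localPenalty_sub_le s _ hμ x y).trans ?_
      rw [mul_assoc]
      exact mul_le_mul hr (hc _) (apply_nonneg s _)
        ((div_nonneg hμ (Real.sqrt_nonneg _)).trans hr)
    have h1 := hb (hρ n) (hr₁ ⟨n, rfl⟩) hc₁
    have h2 := hb (hlam n) (hr₂ ⟨n, rfl⟩) hc₂
    simp only [hg]
    rw [add_sub_add_comm, add_mul]
    exact (abs_add_le _ _).trans (add_le_add h1 h2)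
  have hg₀0 : g₀ 0 = 0 := tendsto_nhds_unique (hglim 0) (by simp [hg0])
  have hg₀Lip : ∀ x y, |g₀ x - g₀ y| ≤ K * ‖x - y‖ := fun x y =>
    le_of_tendsto' ((hglim x).sub (hglim y)).abs fun n => hLip n x y
  have hg₀conv : ConvexOn ℝ Set.univ g₀ := by
    rw [hg₀]
    exact ((convexOn_directionalDeriv hdirN).smul hρ₀).add
      ((convexOn_directionalDeriv hdirL).smul hlam₀)
  obtain ⟨ψ, hψc, hψ⟩ := exists_continuous_minimizer hS hg₀Lip hg₀0 hg₀conv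
  have hSlim := tendsto_gramS hC hD hH
  refine ⟨fun v => matPart (ψ v), fun v => vecPart (ψ v),
    ?_, ?_, ?_, ?_⟩
  · simpa only [stack_matPart_vecPart] using hψc.measurable
  · intro v U β
    have hobj : ∀ (U : Matrix (Fin m) (Fin q) ℝ) (β : Fin p → ℝ),
        limitObjective C D H B γ ρ₀ lam₀ v U β =
        penalizedQuadratic (blockS C D H) g₀ v
          (stack U β) := by
      intro U β
      rw [hg₀, ← limitObjective_eq, matPart_stack,
        vecPart_stack]
    simp only [hobj]
    constructor
    · intro h
      have h1 := (hψ v (stack U β)).1 fun u => by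
        simpa using h (matPart u) (vecPart u)
      rw [← h1]
      simp
    · rintro ⟨rfl, rfl⟩ U' β'
      rw [stack_matPart_vecPart]
      exact (hψ v _).2 rfl _
  · simp only [stack_matPart_vecPart]
    have hW := tendstoInDistribution_gaussian_score (v := σ ^ 2)
      (s := fun i => stack (X i) (z i)) hε_indep hε_law hS.posSemidef
      (fun t => by
        have h1 := ((continuous_quadraticForm.tendsto
          (blockS C D H, t)).comp
            (hSlim.prodMk_nhds (tendsto_const_nhds (x := t))))
        exact h1.congr fun n => gramS_quadraticForm X z n t)
      hw'
    refine tendstoInDistribution_minimizer hSlim hS hLip hg0 hglim hψc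
      (fun v x => (hψ v x).1) hW ?_ ?_
    · intro n
      simp only [stack_sub]
      have h1 := ((hhat_meas n).sub_const (stack B γ)).const_smul (√(n : ℝ))
      exact h1
    · filter_upwards [eventually_ne_atTop 0] with n hn
      filter_upwards [hhat n] with ω hω u
      have hs : √(n : ℝ) ≠ 0 := by positivity
      have heq := mul_objective_eq (X := X) (z := z)
        (b := stack B γ) (y := fun i => y i ω) (e := fun i => ε i ω)
        (by simpa using fun i => hy i ω) ρ lam hn
      -- the local coordinate of the estimator, then that of an arbitrary competitor
      have h1 := heq (√(n : ℝ) • stack (Bhat n ω - B) (γhat n ω - γ))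
      have h2 := heq u
      rw [smul_smul, inv_mul_cancel₀ hs, one_smul, stack_sub, add_sub_cancel,
        matPart_stack, vecPart_stack] at h1
      have h3 := mul_le_mul_of_nonneg_left
        (hω (matPart (stack B γ + (√(n : ℝ))⁻¹ • u))
          (vecPart (stack B γ + (√(n : ℝ))⁻¹ • u)))
        n.cast_nonneg (α := ℝ)
      rw [h1, h2] at h3
      rw [stack_sub, hg]
      exact le_of_add_le_add_right h3
  · intro hρo hlamo
    -- both limits of the scaled penalty parameters vanish, so the limiting penalty does
    have hρ₀0 : ρ₀ = 0 := tendsto_nhds_unique hρ_lim hρo.tendsto_div_nhds_zero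
    have hlam₀0 : lam₀ = 0 := tendsto_nhds_unique hlam_lim hlamo.tendsto_div_nhds_zero
    have hg₀' : g₀ = fun _ => 0 := by
      rw [hg₀, hρ₀0, hlam₀0]
      simp
    have hψinv : ∀ v, ψ v =
        WithLp.toLp 2 ((blockS C D H)⁻¹ *ᵥ v.ofLp) := by
      intro v
      refine ((hψ v _).1 fun u => ?_).symm
      rw [hg₀']
      exact inv_mulVec_minimizes hS v u
    simp only [stack_matPart_vecPart, hψinv, implies_true, true_and]
    have h1 := hasLaw_inv_mulVec hS hw'
    rw [NNReal.coe_pow] at h1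
    exact h1
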